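/- Let $(A,\Delta)$ be a regular multiplier Hopf algebra over $\mathbb C$: an associative algebra $A$ with non-degenerate product (not necessarily unital) and a coassociative homomorphism $\Delta:A\to M(A\otimes A)$ such that $a\otimes b\mapsto\Delta(a)(1\otimes b)$ and $a\otimes b\mapsto(a\otimes 1)\Delta(b)$ are bijections of $A\otimes A$, and such that the same holds for the opposite coproduct $\Delta^{\rm cop}$ ($\Delta$ followed by the flip). Let $S$ be its antipode and write $\Delta(a)=\sum a_{(1)}\otimes a_{(2)}$. Put $(B,\Delta_B)=(A,\Delta^{\rm cop})$, with the right adjoint action of $A$ on $B$ and the left adjoint coaction $\Gamma:A\to M(B\otimes A)$ of $B$ on $A$, $$b\triangleleft a=\sum S(a_{(1)})\,b\,a_{(2)},\qquad \Gamma(a)=\sum S(a_{(1)})a_{(3)}\otimes a_{(2)} .$$ Let $A\# B$ be the smash product, i.e. the space $A\otimes B$ (with $a\# b$ written for $a\otimes b$) with the product $$(a\# b)(a'\# b')=\sum aa'_{(1)}\#(b\triangleleft a'_{(2)})b' ,$$ and let $\Delta_\#:A\# B\to M((A\# B)\otimes(A\# B))$ be given by $$\Delta_\#(a\# b)=\sum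 (a_{(1)}\otimes 1)\,\Gamma(a_{(2)})\,\Delta_B(b),$$ where $A$ and $B$ are regarded as subalgebras of $M(A\# B)$. Then these objects are well defined, $(A\# B,\Delta_\#)$ (the bicrossproduct) and the tensor product $A\otimes B$, with coproduct $(\iota\otimes\sigma\otimes\iota)(\Delta\otimes\Delta_B)$ where $\sigma$ is the flip, are regular multiplier Hopf algebras, and the linear map $\theta:A\otimes B\to A\# B$, $$\theta(a\otimes b)=\sum a_{(1)}\# S(a_{(2)})b ,$$ is a well-defined isomorphism of multiplier Hopf algebras: it is bijective and multiplicative, and $\Delta_\#(\theta(x))=(\theta\otimes\theta)(\Delta_{A\otimes B}(x))$ for all $x\in A\otimes B$. -/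

import Mathlib

open scoped TensorProduct

noncomputable section

/-!  ## Multipliers

Algebras are complex vector spaces with a bilinear product, not necessarily unital. Associativity and
non-degeneracy of the product are part of the definition of a multiplier Hopf algebra below, so that
the smash product can be given its product before that product is known to be associative. -/

section Multipliers

variable (X Y : Type*)
  [NonUnitalNonAssocSemiring X] [Module ℂ X] [SMulCommClass ℂ X X] [IsScalarTower ℂ X X]
  [NonUnitalNonAssocSemiring Y] [Module ℂ Y] [SMulCommClass ℂ Y Y] [IsScalarTower ℂ Y Y]

/-- Pairs of linear operators on `X`; the first one is thought of as multiplication from the left,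
the second one as multiplication from the right, and they are composed accordingly. -/
abbrev BiOp : Type _ := Module.End ℂ X × (Module.End ℂ X)ᵐᵒᵖ

/-- The multiplier algebra `M(X)`: all pairs of operators `z ↦ m z` and `z ↦ z m` which satisfy
`x (m y) = (x m) y`. -/
def multiplierAlgebra : Subalgebra ℂ (BiOp X) where
  carrier := {m | ∀ x y : X, x * m.1 y = m.2.unop x * y}
  mul_mem' := by
    intro m n hm hn x y
    simp only [Set.mem_ofPred_eq] at hm hn
    simp [hm, hn]
  add_mem' := by
    intro m n hm hn x y
    simp only [Set.mem_ofPred_eq] at hm hn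
    simp [hm, hn, mul_add, add_mul]
  algebraMap_mem' := by
    intro r x y
    simp [Algebra.algebraMap_eq_smul_one, mul_smul_comm, smul_mul_assoc]

abbrev Multiplier : Type _ := ↥(multiplierAlgebra X)

variable {X Y}

theorem Multiplier.ext' {m n : Multiplier X} (h₁ : m.1.1 = n.1.1)
    (h₂ : m.1.2.unop = n.1.2.unop) : m = n :=
  Subtype.ext (Prod.ext h₁ (MulOpposite.unop_injective h₂))

/-- An element of `X`, acting on `X` by left and by right multiplication. When the product of `X` is
associative this is the canonical map of `X` into `M(X)`, injective if the product is
non-degenerate. -/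
def BiOp.ofElem (x : X) : BiOp X :=
  (LinearMap.mulLeft ℂ x, MulOpposite.op (LinearMap.mulRight ℂ x))

/-- The operators `m ⊗ n` on `X ⊗ Y`. -/
def BiOp.tensor (m : BiOp X) (n : BiOp Y) : BiOp (X ⊗[ℂ] Y) :=
  (TensorProduct.map m.1 n.1, MulOpposite.op (TensorProduct.map m.2.unop n.2.unop))

/-- The multiplier `m ⊗ n` of `X ⊗ Y`, for multipliers `m` of `X` and `n` of `Y`. -/
def Multiplier.tensor : Multiplier X →ₗ[ℂ] Multiplier Y →ₗ[ℂ] Multiplier (X ⊗[ℂ] Y) :=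
  LinearMap.mk₂ ℂ
    (fun m n => ⟨BiOp.tensor m.1 n.1, by
      intro x y
      induction x with
      | zero => simp
      | add x₁ x₂ h₁ h₂ => simp only [add_mul, map_add, h₁, h₂]
      | tmul x₁ x₂ =>
        induction y with
        | zero => simp
        | add y₁ y₂ h₁ h₂ => simp only [mul_add, map_add, h₁, h₂]
        | tmul y₁ y₂ =>
          have hm := m.2 x₁ y₁
          have hn := n.2 x₂ y₂
          simp [BiOp.tensor, hm, hn]⟩)
    (by intro m m' n; apply Multiplier.ext' <;> simp [BiOp.tensor, TensorProduct.map_add_left])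
    (by intro c m n; apply Multiplier.ext' <;> simp [BiOp.tensor, TensorProduct.map_smul_left])
    (by intro m n n'; apply Multiplier.ext' <;> simp [BiOp.tensor, TensorProduct.map_add_right])
    (by intro c m n; apply Multiplier.ext' <;> simp [BiOp.tensor, TensorProduct.map_smul_right])

/-- The extension of an isomorphism of algebras to the multiplier algebras. -/
def Multiplier.congr (e : X ≃ₗ[ℂ] Y) (he : ∀ x x', e (x * x') = e x * e x') :
    Multiplier X →ₗ[ℂ] Multiplier Y where
  toFun m := ⟨(e.toLinearMap ∘ₗ m.1.1 ∘ₗ e.symm.toLinearMap,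
      MulOpposite.op (e.toLinearMap ∘ₗ m.1.2.unop ∘ₗ e.symm.toLinearMap)), by
    intro x y
    have h := congrArg e (m.2 (e.symm x) (e.symm y))
    simpa [he] using h⟩
  map_add' m n := by apply Multiplier.ext' <;> ext <;> simp
  map_smul' c m := by apply Multiplier.ext' <;> ext <;> simp

end Multipliers

/-!  ## Isomorphisms of tensor product algebras -/

section TensorAlgebras

variable {X Y Z W : Type*}
  [NonUnitalNonAssocSemiring X] [Module ℂ X] [SMulCommClass ℂ X X] [IsScalarTower ℂ X X]
  [NonUnitalNonAssocSemiring Y] [Module ℂ Y] [SMulCommClass ℂ Y Y] [IsScalarTower ℂ Y Y]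
  [NonUnitalNonAssocSemiring Z] [Module ℂ Z] [SMulCommClass ℂ Z Z] [IsScalarTower ℂ Z Z]
  [NonUnitalNonAssocSemiring W] [Module ℂ W] [SMulCommClass ℂ W W] [IsScalarTower ℂ W W]

theorem tensorComm_mul (x y : X ⊗[ℂ] Y) :
    TensorProduct.comm ℂ X Y (x * y)
      = TensorProduct.comm ℂ X Y x * TensorProduct.comm ℂ X Y y := by
  induction x with
  | zero => simp
  | add x₁ x₂ h₁ h₂ => simp only [add_mul, map_add, h₁, h₂]
  | tmul x₁ x₂ =>
    induction y with
    | zero => simp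
    | add y₁ y₂ h₁ h₂ => simp only [mul_add, map_add, h₁, h₂]
    | tmul y₁ y₂ => simp

theorem tensorCongr_mul (e : X ≃ₗ[ℂ] Z) (f : Y ≃ₗ[ℂ] W)
    (he : ∀ x x', e (x * x') = e x * e x') (hf : ∀ y y', f (y * y') = f y * f y')
    (x y : X ⊗[ℂ] Y) :
    TensorProduct.congr e f (x * y) = TensorProduct.congr e f x * TensorProduct.congr e f y := by
  induction x with
  | zero => simp
  | add x₁ x₂ h₁ h₂ => simp only [add_mul, map_add, h₁, h₂]
  | tmul x₁ x₂ =>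
    induction y with
    | zero => simp
    | add y₁ y₂ h₁ h₂ => simp only [mul_add, map_add, h₁, h₂]
    | tmul y₁ y₂ => simp [he, hf]

theorem tensorTensorTensorComm_mul (x y : (X ⊗[ℂ] Y) ⊗[ℂ] (Z ⊗[ℂ] W)) :
    TensorProduct.tensorTensorTensorComm ℂ X Y Z W (x * y)
      = TensorProduct.tensorTensorTensorComm ℂ X Y Z W x
        * TensorProduct.tensorTensorTensorComm ℂ X Y Z W y := by
  induction x with
  | zero => simp
  | add x₁ x₂ h₁ h₂ => simp only [add_mul, map_add, h₁, h₂]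
  | tmul x₁ x₂ =>
    induction y with
    | zero => simp
    | add y₁ y₂ h₁ h₂ => simp only [mul_add, map_add, h₁, h₂]
    | tmul y₁ y₂ =>
      induction x₁ with
      | zero => simp
      | add a b h₁ h₂ => simp only [TensorProduct.add_tmul, add_mul, map_add, h₁, h₂]
      | tmul a₁ a₂ =>
        induction x₂ with
        | zero => simp
        | add a b h₁ h₂ => simp only [TensorProduct.tmul_add, add_mul, map_add, h₁, h₂]
        | tmul a₃ a₄ =>
          induction y₁ with
          | zero => simp
          | add a b h₁ h₂ => simp only [TensorProduct.add_tmul, mul_add, map_add, h₁, h₂]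
          | tmul b₁ b₂ =>
            induction y₂ with
            | zero => simp
            | add a b h₁ h₂ => simp only [TensorProduct.tmul_add, mul_add, map_add, h₁, h₂]
            | tmul b₃ b₄ => simp

/-- `(x ⊗ y) ⊗ (z ⊗ w) ↦ (x ⊗ y') ⊗ (z' ⊗ w)` where `f (y ⊗ z) = y' ⊗ z'`
(with a sum over such terms understood). -/
def onMiddle {U V U' V' P Q : Type*} [AddCommMonoid P] [Module ℂ P] [AddCommMonoid Q] [Module ℂ Q]
    [AddCommMonoid U] [Module ℂ U] [AddCommMonoid V] [Module ℂ V]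
    [AddCommMonoid U'] [Module ℂ U'] [AddCommMonoid V'] [Module ℂ V']
    (f : U ⊗[ℂ] V →ₗ[ℂ] U' ⊗[ℂ] V') :
    (P ⊗[ℂ] U) ⊗[ℂ] (V ⊗[ℂ] Q) →ₗ[ℂ] (P ⊗[ℂ] U') ⊗[ℂ] (V' ⊗[ℂ] Q) :=
  (TensorProduct.assoc ℂ P U' (V' ⊗[ℂ] Q)).symm.toLinearMap
    ∘ₗ ((TensorProduct.assoc ℂ U' V' Q).toLinearMap
        ∘ₗ f.rTensor Q ∘ₗ (TensorProduct.assoc ℂ U V Q).symm.toLinearMap).lTensor P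
    ∘ₗ (TensorProduct.assoc ℂ P U (V ⊗[ℂ] Q)).toLinearMap

end TensorAlgebras

/-!  ## Multiplier Hopf algebras -/

section MultiplierHopf

variable (A : Type*)
  [NonUnitalNonAssocSemiring A] [Module ℂ A] [SMulCommClass ℂ A A] [IsScalarTower ℂ A A]

/-- Multiplier Hopf algebras: an algebra with a non-degenerate product and a coproduct
`Δ : A → M(A ⊗ A)`, a homomorphism such that all `Δ(a)(1 ⊗ b)` and `(a ⊗ 1)Δ(b)` lie in `A ⊗ A`, which
is coassociative, `(a ⊗ 1 ⊗ 1)(Δ ⊗ ι)(Δ(b)(1 ⊗ c)) = (ι ⊗ Δ)((a ⊗ 1)Δ(b))(1 ⊗ 1 ⊗ c)`, and for which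
the maps `T₁ : a ⊗ b ↦ Δ(a)(1 ⊗ b)` and `T₂ : a ⊗ b ↦ (a ⊗ 1)Δ(b)` are bijections of `A ⊗ A`.
(The maps `T₁`, `T₂` are determined by `Δ`.) -/
structure MultiplierHopfAlgebra where
  mul_assoc : ∀ a b c : A, a * b * c = a * (b * c)
  nondeg_left : ∀ a : A, (∀ b, a * b = 0) → a = 0
  nondeg_right : ∀ b : A, (∀ a, a * b = 0) → b = 0
  comul : A →ₗ[ℂ] Multiplier (A ⊗[ℂ] A)
  comul_mul : ∀ a b, comul (a * b) = comul a * comul b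
  T₁ : A ⊗[ℂ] A ≃ₗ[ℂ] A ⊗[ℂ] A
  T₂ : A ⊗[ℂ] A ≃ₗ[ℂ] A ⊗[ℂ] A
  T₁_spec : ∀ a b,
    (comul a : BiOp (A ⊗[ℂ] A)) * BiOp.tensor 1 (BiOp.ofElem b) = BiOp.ofElem (T₁ (a ⊗ₜ b))
  T₂_spec : ∀ a b,
    BiOp.tensor (BiOp.ofElem a) 1 * (comul b : BiOp (A ⊗[ℂ] A)) = BiOp.ofElem (T₂ (a ⊗ₜ b))
  coassoc : ∀ a b c : A,
    TensorProduct.assoc ℂ A A A (T₂.toLinearMap.rTensor A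
        ((TensorProduct.assoc ℂ A A A).symm (a ⊗ₜ T₁ (b ⊗ₜ c))))
      = T₁.toLinearMap.lTensor A (TensorProduct.assoc ℂ A A A (T₂ (a ⊗ₜ b) ⊗ₜ c))

variable {A}

/-- The opposite coproduct `Δ^cop`, i.e. `Δ` followed by the flip, extended to multipliers. -/
def flipComul (Δ : A →ₗ[ℂ] Multiplier (A ⊗[ℂ] A)) : A →ₗ[ℂ] Multiplier (A ⊗[ℂ] A) :=
  Multiplier.congr (TensorProduct.comm ℂ A A) tensorComm_mul ∘ₗ Δ

theorem flipComul_flipComul (Δ : A →ₗ[ℂ] Multiplier (A ⊗[ℂ] A)) :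
    flipComul (flipComul Δ) = Δ := by
  apply LinearMap.ext
  intro a
  apply Multiplier.ext' <;> ext <;> simp [flipComul, Multiplier.congr]

variable (A)

/-- A multiplier Hopf algebra `(A, Δ)` is regular if `(A, Δ^cop)` is a multiplier Hopf algebra. -/
structure RegularMultiplierHopfAlgebra extends MultiplierHopfAlgebra A where
  copHopf : MultiplierHopfAlgebra A
  copHopf_comul : copHopf.comul = flipComul comul

variable {A}

namespace MultiplierHopfAlgebra

variable (H : MultiplierHopfAlgebra A)

/-- The counit: `(ε ⊗ ι)(Δ(a)(1 ⊗ b)) = ab` and `(ι ⊗ ε)((a ⊗ 1)Δ(b)) = ab`. -/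
def IsCounit (ε : A →ₗ[ℂ] ℂ) : Prop :=
  (∀ a b, TensorProduct.lid ℂ A (ε.rTensor A (H.T₁ (a ⊗ₜ b))) = a * b) ∧
  (∀ a b, TensorProduct.rid ℂ A (ε.lTensor A (H.T₂ (a ⊗ₜ b))) = a * b)

open Classical in
/-- The counit of `(A, Δ)` (it is unique; the default value `0` is never used). -/
def counit : A →ₗ[ℂ] ℂ := if h : ∃ ε, H.IsCounit ε then h.choose else 0

/-- The antipode, as a linear map from `A` to `A`:
`m(S ⊗ ι)(Δ(a)(1 ⊗ b)) = ε(a)b` and `m(ι ⊗ S)((a ⊗ 1)Δ(b)) = ε(b)a`. -/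
def IsAntipode (S : A →ₗ[ℂ] A) : Prop :=
  (∀ a b, LinearMap.mul' ℂ A (S.rTensor A (H.T₁ (a ⊗ₜ b))) = H.counit a • b) ∧
  (∀ a b, LinearMap.mul' ℂ A (S.lTensor A (H.T₂ (a ⊗ₜ b))) = H.counit b • a)

open Classical in
/-- The antipode of a regular multiplier Hopf algebra (it is unique, and maps `A` to `A`; the default
value `0` is never used for these). -/
def antipode : A →ₗ[ℂ] A := if h : ∃ S, H.IsAntipode S then h.choose else 0

end MultiplierHopfAlgebra

/-- `(A, Δ^cop)`, again a regular multiplier Hopf algebra. -/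
def RegularMultiplierHopfAlgebra.cop (H : RegularMultiplierHopfAlgebra A) :
    RegularMultiplierHopfAlgebra A :=
  { H.copHopf with
    copHopf := H.toMultiplierHopfAlgebra
    copHopf_comul := by rw [H.copHopf_comul, flipComul_flipComul] }

variable {B : Type*}
  [NonUnitalNonAssocSemiring B] [Module ℂ B] [SMulCommClass ℂ B B] [IsScalarTower ℂ B B]

/-- The coproduct `(ι ⊗ σ ⊗ ι)(Δ_A ⊗ Δ_B)` of the tensor product, where `σ` is the flip. -/
def tensorComul (ΔA : A →ₗ[ℂ] Multiplier (A ⊗[ℂ] A)) (ΔB : B →ₗ[ℂ] Multiplier (B ⊗[ℂ] B)) :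
    A ⊗[ℂ] B →ₗ[ℂ] Multiplier ((A ⊗[ℂ] B) ⊗[ℂ] (A ⊗[ℂ] B)) :=
  Multiplier.congr (TensorProduct.tensorTensorTensorComm ℂ A A B B) tensorTensorTensorComm_mul
    ∘ₗ TensorProduct.lift (Multiplier.tensor.compl₁₂ ΔA ΔB)

/-- `e` is an isomorphism of multiplier Hopf algebras: an isomorphism of algebras with
`Δ_B(e(a)) = (e ⊗ e)(Δ_A(a))`. -/
def MultiplierHopfAlgebra.IsIso (H : MultiplierHopfAlgebra A) (K : MultiplierHopfAlgebra B)
    (e : A ≃ₗ[ℂ] B) : Prop :=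
  ∃ he : ∀ a a', e (a * a') = e a * e a',
    ∀ a, K.comul (e a)
      = Multiplier.congr (TensorProduct.congr e e) (tensorCongr_mul e e he he) (H.comul a)

end MultiplierHopf

/-!  ## Smash products and bicrossproducts -/

section Bicross

variable {A B : Type*}
  [NonUnitalNonAssocSemiring A] [Module ℂ A] [SMulCommClass ℂ A A] [IsScalarTower ℂ A A]
  [NonUnitalNonAssocSemiring B] [Module ℂ B] [SMulCommClass ℂ B B] [IsScalarTower ℂ B B]

/-- The twist map `R(b ⊗ a) = ∑ a₍₁₎ ⊗ (b ◁ a₍₂₎)` of a right action `act b a = b ◁ a`, characterized by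
`(p ⊗ 1)R(b ⊗ a) = (ι ⊗ (b ◁ ·))((p ⊗ 1)Δ(a))` for all `p` in `A`. -/
def IsSmashTwist (H : MultiplierHopfAlgebra A) (act : B →ₗ[ℂ] A →ₗ[ℂ] B)
    (R : B ⊗[ℂ] A →ₗ[ℂ] A ⊗[ℂ] B) : Prop :=
  ∀ (p : A) (b : B) (a : A),
    (LinearMap.mulLeft ℂ p).rTensor B (R (b ⊗ₜ a)) = (act b).lTensor A (H.T₂ (p ⊗ₜ a))

open Classical in
/-- The twist map (it is unique; the default value `0` is never used for unital actions). -/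
def smashTwist (H : MultiplierHopfAlgebra A) (act : B →ₗ[ℂ] A →ₗ[ℂ] B) :
    B ⊗[ℂ] A →ₗ[ℂ] A ⊗[ℂ] B :=
  if h : ∃ R, IsSmashTwist H act R then h.choose else 0

/-- The smash product `A # B`, with underlying space `A ⊗ B`. -/
def SmashProduct (_H : MultiplierHopfAlgebra A) (_act : B →ₗ[ℂ] A →ₗ[ℂ] B) : Type _ := A ⊗[ℂ] B

namespace SmashProduct

variable (H : MultiplierHopfAlgebra A) (act : B →ₗ[ℂ] A →ₗ[ℂ] B)

instance : AddCommMonoid (SmashProduct H act) := inferInstanceAs (AddCommMonoid (A ⊗[ℂ] B))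

instance : Module ℂ (SmashProduct H act) := inferInstanceAs (Module ℂ (A ⊗[ℂ] B))

/-- The identity map from `A ⊗ B` to `A # B`; it sends `a ⊗ b` to `a # b`. -/
def ofTensor : A ⊗[ℂ] B ≃ₗ[ℂ] SmashProduct H act := LinearEquiv.refl ℂ (A ⊗[ℂ] B)

/-- The product `(a # b)(a' # b') = ∑ a a'₍₁₎ # (b ◁ a'₍₂₎) b'`. -/
def mulMap : (A ⊗[ℂ] B) ⊗[ℂ] (A ⊗[ℂ] B) →ₗ[ℂ] A ⊗[ℂ] B :=
  TensorProduct.map (LinearMap.mul' ℂ A) (LinearMap.mul' ℂ B) ∘ₗ onMiddle (smashTwist H act)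

instance : Mul (SmashProduct H act) where
  mul x y := ofTensor H act
    (mulMap H act ((ofTensor H act).symm x ⊗ₜ (ofTensor H act).symm y))

theorem mul_def (x y : SmashProduct H act) :
    x * y = ofTensor H act (mulMap H act ((ofTensor H act).symm x ⊗ₜ (ofTensor H act).symm y)) :=
  rfl

instance : NonUnitalNonAssocSemiring (SmashProduct H act) where
  left_distrib x y z := by simp only [mul_def, map_add, TensorProduct.tmul_add]
  right_distrib x y z := by simp only [mul_def, map_add, TensorProduct.add_tmul]
  zero_mul x := by simp only [mul_def, map_zero, TensorProduct.zero_tmul]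
  mul_zero x := by simp only [mul_def, map_zero, TensorProduct.tmul_zero]

instance : SMulCommClass ℂ (SmashProduct H act) (SmashProduct H act) where
  smul_comm c x y := by
    simp only [smul_eq_mul, mul_def, map_smul, TensorProduct.tmul_smul]

instance : IsScalarTower ℂ (SmashProduct H act) (SmashProduct H act) where
  smul_assoc c x y := by
    rw [smul_eq_mul, smul_eq_mul, mul_def, mul_def, map_smul, ← TensorProduct.smul_tmul', map_smul,
      map_smul]

/-- The element `a` of `A` as a multiplier of `A # B`:
`a (a' # b') = a a' # b'` and `(a' # b') a = ∑ a' a₍₁₎ # (b' ◁ a₍₂₎)`. -/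
def inl (a : A) : BiOp (SmashProduct H act) :=
  ((ofTensor H act).conj ((LinearMap.mulLeft ℂ a).rTensor B),
   MulOpposite.op ((ofTensor H act).conj
    ((LinearMap.mul' ℂ A).rTensor B ∘ₗ (TensorProduct.assoc ℂ A A B).symm.toLinearMap
      ∘ₗ (smashTwist H act ∘ₗ (TensorProduct.mk ℂ B A).flip a).lTensor A)))

/-- The element `b` of `B` as a multiplier of `A # B`:
`b (a' # b') = ∑ a'₍₁₎ # (b ◁ a'₍₂₎) b'` and `(a' # b') b = a' # b' b`. -/
def inr (b : B) : BiOp (SmashProduct H act) :=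
  ((ofTensor H act).conj
    ((LinearMap.mul' ℂ B).lTensor A ∘ₗ (TensorProduct.assoc ℂ A B B).toLinearMap
      ∘ₗ (smashTwist H act ∘ₗ TensorProduct.mk ℂ B A b).rTensor B),
   MulOpposite.op ((ofTensor H act).conj ((LinearMap.mulRight ℂ b).lTensor A)))

end SmashProduct

/-- `Δ#` is the coproduct `Δ#(a # b) = ∑ (a₍₁₎ ⊗ 1) Γ(a₍₂₎) Δ_B(b)` of the bicrossproduct, for a coaction
`Γ : A → M(B ⊗ A)`. The formula is covered by multiplying with `p ⊗ 1` from the left, `p` in `A`, and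
with `1 ⊗ q` from the right, `q` in `B`: then
`(p ⊗ 1) Δ#(a # b) (1 ⊗ q) = ∑ (p a₍₁₎ ⊗ 1) (Γ(a₍₂₎)(b₍₁₎ ⊗ 1)) (1 ⊗ b₍₂₎ q)`,
where `TΓ(a ⊗ b) = Γ(a)(b ⊗ 1)` has values in `B ⊗ A`, and where `x y` is `x # y` in `A # B` for
`x` in `A` and `y` in `B`. This determines `Δ#`. -/
def IsBicrossComul (HA : MultiplierHopfAlgebra A) (HB : MultiplierHopfAlgebra B)
    (act : B →ₗ[ℂ] A →ₗ[ℂ] B) (Γ : A →ₗ[ℂ] Multiplier (B ⊗[ℂ] A))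
    (Δ : SmashProduct HA act →ₗ[ℂ] Multiplier (SmashProduct HA act ⊗[ℂ] SmashProduct HA act)) :
    Prop :=
  ∃ TΓ : A ⊗[ℂ] B →ₗ[ℂ] B ⊗[ℂ] A,
    (∀ a b, (Γ a : BiOp (B ⊗[ℂ] A)) * BiOp.tensor (BiOp.ofElem b) 1
      = BiOp.ofElem (TΓ (a ⊗ₜ b))) ∧
    ∀ (p a : A) (b q : B),
      BiOp.tensor (SmashProduct.inl HA act p) 1
          * (Δ (SmashProduct.ofTensor HA act (a ⊗ₜ b)) :
              BiOp (SmashProduct HA act ⊗[ℂ] SmashProduct HA act))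
          * BiOp.tensor 1 (SmashProduct.inr HA act q)
        = BiOp.ofElem (TensorProduct.map
            (SmashProduct.ofTensor HA act).toLinearMap (SmashProduct.ofTensor HA act).toLinearMap
            (onMiddle TΓ (HA.T₂ (p ⊗ₜ a) ⊗ₜ HB.T₁ (b ⊗ₜ q))))

end Bicross

/-!  ## The adjoint action and the adjoint coaction of `A` and `(A, Δ^cop)` -/

namespace RegularMultiplierHopfAlgebra

variable {A : Type*}
  [NonUnitalNonAssocSemiring A] [Module ℂ A] [SMulCommClass ℂ A A] [IsScalarTower ℂ A A]
  (H : RegularMultiplierHopfAlgebra A)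

/-- `T₄(b ⊗ a) = (1 ⊗ b)Δ(a)`, the flip of `(b ⊗ 1)Δ^cop(a)`. -/
def T₄ : A ⊗[ℂ] A →ₗ[ℂ] A ⊗[ℂ] A :=
  (TensorProduct.comm ℂ A A).toLinearMap ∘ₗ H.cop.T₂.toLinearMap

/-- The adjoint action `b ◁ a = ∑ S(a₍₁₎) b a₍₂₎`, that is `m(S ⊗ ι)((1 ⊗ b)Δ(a))`. -/
def adjointAction : A →ₗ[ℂ] A →ₗ[ℂ] A :=
  TensorProduct.curry (LinearMap.mul' ℂ A ∘ₗ H.antipode.rTensor A ∘ₗ H.T₄)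

/-- `(a ⊗ b) ⊗ c ↦ ∑ S(a₍₁₎) a₍₃₎ b ⊗ a₍₂₎ c`: from `Δ(a)(1 ⊗ b) = ∑ p ⊗ q` one passes to
`∑ (Δ(p)(1 ⊗ c)) ⊗ q`, and then to `∑ S(p₍₁₎) q ⊗ p₍₂₎ c`. -/
def adjointCoactionMap : (A ⊗[ℂ] A) ⊗[ℂ] A →ₗ[ℂ] A ⊗[ℂ] A :=
  (LinearMap.mul' ℂ A ∘ₗ H.antipode.rTensor A).rTensor A
    ∘ₗ (TensorProduct.rightComm ℂ A A A).toLinearMap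
    ∘ₗ H.T₁.toLinearMap.rTensor A
    ∘ₗ (TensorProduct.rightComm ℂ A A A).toLinearMap
    ∘ₗ H.T₁.toLinearMap.rTensor A

/-- `Γ` is the adjoint coaction `Γ(a) = ∑ S(a₍₁₎) a₍₃₎ ⊗ a₍₂₎`, a multiplier of `B ⊗ A` with `B = A` as an
algebra. -/
def IsAdjointCoaction (Γ : A →ₗ[ℂ] Multiplier (A ⊗[ℂ] A)) : Prop :=
  ∀ a b c, (Γ a).1.1 (b ⊗ₜ c) = H.adjointCoactionMap ((a ⊗ₜ b) ⊗ₜ c)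

/-- `θ(a ⊗ b) = ∑ a₍₁₎ # S(a₍₂₎) b`, covered by multiplying the first factor with `p` in `A` from the left:
`∑ p a₍₁₎ # S(a₍₂₎) b` is `(ι ⊗ S(·) b)((p ⊗ 1)Δ(a))`. This determines `θ`. -/
def IsTheta (θ : A ⊗[ℂ] A →ₗ[ℂ] SmashProduct H.toMultiplierHopfAlgebra H.adjointAction) : Prop :=
  ∀ p a b : A,
    (LinearMap.mulLeft ℂ p).rTensor A ((SmashProduct.ofTensor _ _).symm (θ (a ⊗ₜ b)))
      = (LinearMap.mulRight ℂ b ∘ₗ H.antipode).lTensor A (H.T₂ (p ⊗ₜ a))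

end RegularMultiplierHopfAlgebra

end

/-! The whole statement is governed by the single bijection `T₁`, which sends a # b to Δ(a)(1 ⊗ b).
In Sweedler notation its inverse is a ⊗ b ↦ ∑ a₍₁₎ ⊗ S(a₍₂₎)b, so θ is the inverse of `T₁`, and
bijectivity is part of the axioms.

Multiplicativity comes from the commutation rule (1 ⊗ b)Δ(a) = ∑ Δ(a₍₁₎)(1 ⊗ (b ◁ a₍₂₎)), which
holds because a₍₂₎S(a₍₃₎) collapses. It says that `T₁` carries the twist map to (1 ⊗ b)Δ(a)
(`T₁_smashTwist`), hence the smash product to the product of A ⊗ A (`T₁_mulMap`). Under this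
identification the multiplier a of A # B becomes Δ(a) and b becomes 1 ⊗ b (`inl_eq`, `inr_eq`).

The bicrossproduct can therefore be obtained by transporting the tensor product of (A, Δ) and (A,
Δ^cop) along θ. All axioms, regularity and the isomorphism property are then automatic. What remains
is that the transported coproduct is the one given by the coaction Γ. Without covers this is the
identity (T₁ ⊗ T₁)(∑ a₍₁₎ ⊗ S(a₍₂₎)a₍₄₎ ⊗ a₍₃₎ ⊗ 1) = ∑ a₍₁₎ ⊗ a₍₄₎ ⊗ a₍₂₎ ⊗ a₍₃₎, whose right side
is the coproduct of A ⊗ B applied to Δ(a). The covered form is `tensorComul_covered`.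

Nothing here lies in A ⊗ A until it is covered, so Sweedler identities are proved by multiplying a
leg by an arbitrary element, using coassociativity, and cancelling by non-degeneracy. Counit and
antipode are not part of the data and are first constructed from the bijectivity of `T₁` and `T₂`.
-/

set_option linter.unusedSectionVars false

open scoped TensorProduct

noncomputable section

/-! ### Separating families of maps on one tensor leg. -/

section Nondegenerate

variable {V W : Type*} [AddCommGroup V] [Module ℂ V] [AddCommGroup W] [Module ℂ W]
  {ι : Type*} {U : Type*} [AddCommGroup U] [Module ℂ U]

/-- Over a field, an element of V ⊗ W is a finite family of elements of W indexed by a basis of V.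
Each map acts coefficientwise, so the difference vanishes coefficient by coefficient. -/
theorem lTensor_jointly_injective (f : ι → W →ₗ[ℂ] U) (hf : ∀ w, (∀ i, f i w = 0) → w = 0)
    {z z' : V ⊗[ℂ] W} (h : ∀ i, (f i).lTensor V z = (f i).lTensor V z') : z = z' := by
  classical
  let b := Module.Basis.ofVectorSpace ℂ V
  have key : ∀ i (y : V ⊗[ℂ] W) j,
      TensorProduct.equivFinsuppOfBasisLeft b ((f i).lTensor V y) j
        = f i (TensorProduct.equivFinsuppOfBasisLeft b y j) := by
    intro i y j
    induction y with
    | zero => simp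
    | add x y hx hy => simp only [map_add, Finsupp.add_apply, hx, hy]
    | tmul v w => simp
  rw [← sub_eq_zero]
  apply (TensorProduct.equivFinsuppOfBasisLeft b).injective
  ext j
  rw [map_zero, Finsupp.zero_apply]
  apply hf
  intro i
  rw [← key, map_sub, h, sub_self, map_zero, Finsupp.zero_apply]

theorem rTensor_jointly_injective (f : ι → W →ₗ[ℂ] U) (hf : ∀ w, (∀ i, f i w = 0) → w = 0)
    {z z' : W ⊗[ℂ] V} (h : ∀ i, (f i).rTensor V z = (f i).rTensor V z') : z = z' := by
  apply (TensorProduct.comm ℂ W V).injective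
  apply lTensor_jointly_injective f hf
  intro i
  have key : ∀ y : W ⊗[ℂ] V, (f i).lTensor V (TensorProduct.comm ℂ W V y)
      = TensorProduct.comm ℂ (U) V ((f i).rTensor V y) := by
    intro y
    induction y with
    | zero => simp
    | add x y hx hy => simp only [map_add, hx, hy]
    | tmul v w => simp
  rw [key, key, h]

end Nondegenerate

/-! ### Associativity and non-degeneracy of tensor product algebras. -/

section TensorMul

variable {X Y : Type*}
  [NonUnitalNonAssocSemiring X] [Module ℂ X] [SMulCommClass ℂ X X] [IsScalarTower ℂ X X]
  [NonUnitalNonAssocSemiring Y] [Module ℂ Y] [SMulCommClass ℂ Y Y] [IsScalarTower ℂ Y Y]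

theorem tensor_mul_assoc (hX : ∀ a b c : X, a * b * c = a * (b * c))
    (hY : ∀ a b c : Y, a * b * c = a * (b * c)) (x y z : X ⊗[ℂ] Y) :
    x * y * z = x * (y * z) := by
  induction x with
  | zero => simp
  | add x₁ x₂ h₁ h₂ => simp only [add_mul, h₁, h₂]
  | tmul x₁ x₂ =>
    induction y with
    | zero => simp
    | add y₁ y₂ h₁ h₂ => simp only [mul_add, add_mul, h₁, h₂]
    | tmul y₁ y₂ =>
      induction z with
      | zero => simp
      | add z₁ z₂ h₁ h₂ => simp only [mul_add, h₁, h₂]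
      | tmul z₁ z₂ => simp [hX, hY]

/-- Multipliers of a non-degenerate algebra are determined by their left action. -/
theorem Multiplier.ext_left (hX : ∀ a b : X, (∀ c, a * c = b * c) → a = b)
    {m n : BiOp X} (hm : m ∈ multiplierAlgebra X) (hn : n ∈ multiplierAlgebra X)
    (h : m.1 = n.1) : m = n := by
  refine Prod.ext h (MulOpposite.unop_injective ?_)
  ext x
  apply hX
  intro c
  rw [← hm x c, ← hn x c, h]

theorem BiOp.ofElem_mem (hX : ∀ a b c : X, a * b * c = a * (b * c)) (x : X) :
    BiOp.ofElem x ∈ multiplierAlgebra X := by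
  intro y z
  simp [BiOp.ofElem, hX]

end TensorMul

section TensorNondeg

variable {X Y : Type*}
  [NonUnitalRing X] [Module ℂ X] [SMulCommClass ℂ X X] [IsScalarTower ℂ X X]
  [NonUnitalRing Y] [Module ℂ Y] [SMulCommClass ℂ Y Y] [IsScalarTower ℂ Y Y]

theorem mul_tmul_eq (z : X ⊗[ℂ] Y) (u : X) (v : Y) :
    z * (u ⊗ₜ v) = (LinearMap.mulRight ℂ v).lTensor X ((LinearMap.mulRight ℂ u).rTensor Y z) := by
  induction z with
  | zero => simp
  | add x y hx hy => simp only [add_mul, map_add, hx, hy]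
  | tmul x y => simp

theorem rTensor_mulRight_lTensor_mulRight (u : X) (c : Y) (z : X ⊗[ℂ] Y) :
    (LinearMap.mulRight ℂ u).rTensor Y ((LinearMap.mulRight ℂ c).lTensor X z) = z * (u ⊗ₜ c) := by
  induction z with
  | zero => simp
  | add x y hx hy => simp only [add_mul, map_add, hx, hy]
  | tmul x y => simp

theorem tmul_mul_eq (z : X ⊗[ℂ] Y) (u : X) (v : Y) :
    (u ⊗ₜ v) * z = (LinearMap.mulLeft ℂ v).lTensor X ((LinearMap.mulLeft ℂ u).rTensor Y z) := by
  induction z with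
  | zero => simp
  | add x y hx hy => simp only [mul_add, map_add, hx, hy]
  | tmul x y => simp

theorem tensor_nondeg_left (hX : ∀ a : X, (∀ b, a * b = 0) → a = 0)
    (hY : ∀ a : Y, (∀ b, a * b = 0) → a = 0) {z z' : X ⊗[ℂ] Y}
    (h : ∀ u v, z * (u ⊗ₜ v) = z' * (u ⊗ₜ v)) : z = z' := by
  apply rTensor_jointly_injective (fun u => LinearMap.mulRight ℂ u) (by simpa using hX)
  intro u
  apply lTensor_jointly_injective (fun v => LinearMap.mulRight ℂ v) (by simpa using hY)
  intro v
  simpa only [mul_tmul_eq] using h u v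

theorem tensor_nondeg_right (hX : ∀ b : X, (∀ a, a * b = 0) → b = 0)
    (hY : ∀ b : Y, (∀ a, a * b = 0) → b = 0) {z z' : X ⊗[ℂ] Y}
    (h : ∀ u v, (u ⊗ₜ v) * z = (u ⊗ₜ v) * z') : z = z' := by
  apply rTensor_jointly_injective (fun u => LinearMap.mulLeft ℂ u) (by simpa using hX)
  intro u
  apply lTensor_jointly_injective (fun v => LinearMap.mulLeft ℂ v) (by simpa using hY)
  intro v
  simpa only [tmul_mul_eq] using h u v

end TensorNondeg

/-! ### The coproduct as a left operator and the module properties of `T₁` and `T₂`. -/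

namespace MultiplierHopfAlgebra

variable {A : Type*} [NonUnitalRing A] [Module ℂ A] [SMulCommClass ℂ A A] [IsScalarTower ℂ A A]

theorem ext_right (H : MultiplierHopfAlgebra A) {a b : A} (h : ∀ c, a * c = b * c) : a = b := by
  rw [← sub_eq_zero]
  exact H.nondeg_left _ fun c => by rw [sub_mul, h, sub_self]

theorem tensor_ext_right (H : MultiplierHopfAlgebra A) {z z' : A ⊗[ℂ] A}
    (h : ∀ u v, z * (u ⊗ₜ v) = z' * (u ⊗ₜ v)) : z = z' :=
  tensor_nondeg_left H.nondeg_left H.nondeg_left h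

theorem tensor_ext_left (H : MultiplierHopfAlgebra A) {z z' : A ⊗[ℂ] A}
    (h : ∀ u v, (u ⊗ₜ v) * z = (u ⊗ₜ v) * z') : z = z' :=
  tensor_nondeg_right H.nondeg_right H.nondeg_right h

section Slots

variable {V : Type*} [AddCommGroup V] [Module ℂ V]

theorem lTensor_ext_right (H : MultiplierHopfAlgebra A) {z z' : V ⊗[ℂ] A}
    (h : ∀ c, (LinearMap.mulRight ℂ c).lTensor V z = (LinearMap.mulRight ℂ c).lTensor V z') :
    z = z' :=
  by
    refine lTensor_jointly_injective (fun c : A => LinearMap.mulRight ℂ c) ?_ h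
    intro w hw
    exact H.nondeg_left w hw

theorem rTensor_ext_right (H : MultiplierHopfAlgebra A) {z z' : A ⊗[ℂ] V}
    (h : ∀ c, (LinearMap.mulRight ℂ c).rTensor V z = (LinearMap.mulRight ℂ c).rTensor V z') :
    z = z' :=
  by
    refine rTensor_jointly_injective (fun c : A => LinearMap.mulRight ℂ c) ?_ h
    intro w hw
    exact H.nondeg_left w hw

theorem rTensor_ext_left (H : MultiplierHopfAlgebra A) {z z' : A ⊗[ℂ] V}
    (h : ∀ c, (LinearMap.mulLeft ℂ c).rTensor V z = (LinearMap.mulLeft ℂ c).rTensor V z') :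
    z = z' :=
  by
    refine rTensor_jointly_injective (fun c : A => LinearMap.mulLeft ℂ c) ?_ h
    intro w hw
    exact H.nondeg_right w hw

end Slots

variable (H : MultiplierHopfAlgebra A)

/-- The left action `z ↦ Δ(a) z`. -/
def comulLeft : A →ₗ[ℂ] Module.End ℂ (A ⊗[ℂ] A) :=
  LinearMap.fst ℂ _ _ ∘ₗ (multiplierAlgebra (A ⊗[ℂ] A)).val.toLinearMap ∘ₗ H.comul

/-- The right action `z ↦ z Δ(a)`. -/
def comulRight (a : A) : Module.End ℂ (A ⊗[ℂ] A) := (H.comul a).1.2.unop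

theorem comulLeft_apply (a : A) : H.comulLeft a = (H.comul a).1.1 := rfl

theorem mul_comulLeft (a : A) (w z : A ⊗[ℂ] A) :
    w * H.comulLeft a z = H.comulRight a w * z := (H.comul a).2 w z

theorem comulLeft_mul_right (a : A) (z w : A ⊗[ℂ] A) :
    H.comulLeft a (z * w) = H.comulLeft a z * w := by
  apply H.tensor_ext_left
  intro u v
  rw [mul_comulLeft, ← _root_.mul_assoc, ← _root_.mul_assoc, mul_comulLeft]

theorem comulLeft_mul (a b : A) (z : A ⊗[ℂ] A) :
    H.comulLeft (a * b) z = H.comulLeft a (H.comulLeft b z) := by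
  simp only [comulLeft_apply, H.comul_mul]
  rfl

theorem mul_lTensor_mulRight (u : A) (w z : A ⊗[ℂ] A) :
    w * (LinearMap.mulRight ℂ u).lTensor A z = (LinearMap.mulRight ℂ u).lTensor A (w * z) := by
  induction z with
  | zero => simp
  | add x y hx hy => simp only [mul_add, map_add, hx, hy]
  | tmul x y =>
    induction w with
    | zero => simp
    | add x y hx hy => simp only [add_mul, map_add, hx, hy]
    | tmul v w => simp [_root_.mul_assoc]

theorem comulLeft_lTensor (a u : A) (z : A ⊗[ℂ] A) :
    H.comulLeft a ((LinearMap.mulRight ℂ u).lTensor A z)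
      = (LinearMap.mulRight ℂ u).lTensor A (H.comulLeft a z) := by
  apply H.tensor_ext_left
  intro v w
  rw [mul_comulLeft, mul_lTensor_mulRight, mul_lTensor_mulRight, mul_comulLeft]

theorem T₁_mul (a b : A) (z : A ⊗[ℂ] A) :
    H.T₁ (a ⊗ₜ b) * z = H.comulLeft a ((LinearMap.mulLeft ℂ b).lTensor A z) := by
  have := LinearMap.congr_fun (congrArg Prod.fst (H.T₁_spec a b)) z
  exact this.symm

theorem T₂_mul (a b : A) (z : A ⊗[ℂ] A) :
    H.T₂ (a ⊗ₜ b) * z = (LinearMap.mulLeft ℂ a).rTensor A (H.comulLeft b z) := by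
  have := LinearMap.congr_fun (congrArg Prod.fst (H.T₂_spec a b)) z
  exact this.symm

theorem comulLeft_tmul (a u b : A) :
    H.comulLeft a (u ⊗ₜ b) = (LinearMap.mulRight ℂ u).rTensor A (H.T₁ (a ⊗ₜ b)) := by
  apply H.lTensor_ext_right
  intro v
  rw [← mul_tmul_eq, T₁_mul, LinearMap.lTensor_tmul, ← comulLeft_lTensor]
  simp

theorem T₁_lTensor (c : A) (z : A ⊗[ℂ] A) :
    H.T₁ ((LinearMap.mulRight ℂ c).lTensor A z) = (LinearMap.mulRight ℂ c).lTensor A (H.T₁ z) := by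
  induction z with
  | zero => simp
  | add x y hx hy => simp only [map_add, hx, hy]
  | tmul a b =>
    apply H.rTensor_ext_right
    intro u
    rw [LinearMap.lTensor_tmul, ← comulLeft_tmul, ← LinearMap.comp_apply (LinearMap.rTensor A _),
      LinearMap.rTensor_comp_lTensor, ← LinearMap.lTensor_comp_rTensor, LinearMap.comp_apply,
      ← comulLeft_tmul, ← comulLeft_lTensor]
    simp

theorem T₁_mul_left (a : A) (z : A ⊗[ℂ] A) :
    H.T₁ ((LinearMap.mulLeft ℂ a).rTensor A z) = H.comulLeft a (H.T₁ z) := by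
  induction z with
  | zero => simp
  | add x y hx hy => simp only [map_add, hx, hy]
  | tmul b c =>
    apply H.tensor_ext_right
    intro u v
    rw [← comulLeft_mul_right, T₁_mul, ← comulLeft_mul, LinearMap.rTensor_tmul, T₁_mul]
    simp

/-- Both sides are (a ⊗ 1)Δ(b)(1 ⊗ c). This is the device for exchanging a left cover for a right
one. -/
theorem lTensor_T₂ (a b c : A) :
    (LinearMap.mulRight ℂ c).lTensor A (H.T₂ (a ⊗ₜ b))
      = (LinearMap.mulLeft ℂ a).rTensor A (H.T₁ (b ⊗ₜ c)) := by
  apply H.rTensor_ext_right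
  intro u
  rw [rTensor_mulRight_lTensor_mulRight, T₂_mul, comulLeft_tmul]
  generalize H.T₁ (b ⊗ₜ c) = z
  induction z with
  | zero => simp
  | add x y hx hy => simp only [map_add, hx, hy]
  | tmul x y => simp [_root_.mul_assoc]

end MultiplierHopfAlgebra

/-! ### Construction of the counit and of the maps S(a)b and bS(a). -/

namespace MultiplierHopfAlgebra

variable {A : Type*} [NonUnitalRing A] [Module ℂ A] [SMulCommClass ℂ A A] [IsScalarTower ℂ A A]
  (H : MultiplierHopfAlgebra A)

/-- `T₂` on the first two legs of `A ⊗ A ⊗ A`. -/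
def leg₁₂ : A ⊗[ℂ] (A ⊗[ℂ] A) ≃ₗ[ℂ] A ⊗[ℂ] (A ⊗[ℂ] A) :=
  (TensorProduct.assoc ℂ A A A).symm ≪≫ₗ H.T₂.rTensor A ≪≫ₗ TensorProduct.assoc ℂ A A A

/-- `T₁` on the last two legs of `A ⊗ A ⊗ A`. -/
def leg₂₃ : A ⊗[ℂ] (A ⊗[ℂ] A) ≃ₗ[ℂ] A ⊗[ℂ] (A ⊗[ℂ] A) := H.T₁.lTensor A

theorem leg₁₂_tmul (a b c : A) :
    H.leg₁₂ (a ⊗ₜ (b ⊗ₜ c)) = TensorProduct.assoc ℂ A A A (H.T₂ (a ⊗ₜ b) ⊗ₜ c) := rfl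

theorem leg₁₂_symm_tmul (a b c : A) :
    H.leg₁₂.symm (a ⊗ₜ (b ⊗ₜ c)) = TensorProduct.assoc ℂ A A A (H.T₂.symm (a ⊗ₜ b) ⊗ₜ c) := rfl

theorem leg₂₃_tmul (a : A) (z : A ⊗[ℂ] A) : H.leg₂₃ (a ⊗ₜ z) = a ⊗ₜ H.T₁ z := rfl

theorem leg₂₃_symm_tmul (a : A) (z : A ⊗[ℂ] A) : H.leg₂₃.symm (a ⊗ₜ z) = a ⊗ₜ H.T₁.symm z := rfl

theorem leg₂₃_apply (y : A ⊗[ℂ] (A ⊗[ℂ] A)) : H.leg₂₃ y = H.T₁.toLinearMap.lTensor A y := rfl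

/-- Coassociativity, read as commutation of two invertible operators. In this form it passes to the
inverses, which is where counit and antipode come from. -/
theorem leg₁₂_leg₂₃ (y : A ⊗[ℂ] (A ⊗[ℂ] A)) : H.leg₁₂ (H.leg₂₃ y) = H.leg₂₃ (H.leg₁₂ y) := by
  induction y with
  | zero => simp
  | add x y hx hy => simp only [map_add, hx, hy]
  | tmul a z =>
    induction z with
    | zero => simp
    | add x y hx hy => simp only [TensorProduct.tmul_add, map_add, hx, hy]
    | tmul b c => exact H.coassoc a b c

theorem leg₁₂_symm_leg₂₃ (y : A ⊗[ℂ] (A ⊗[ℂ] A)) :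
    H.leg₁₂.symm (H.leg₂₃ y) = H.leg₂₃ (H.leg₁₂.symm y) := by
  apply H.leg₁₂.injective
  rw [leg₁₂_leg₂₃, LinearEquiv.apply_symm_apply, LinearEquiv.apply_symm_apply]

theorem leg₂₃_symm_leg₁₂ (y : A ⊗[ℂ] (A ⊗[ℂ] A)) :
    H.leg₂₃.symm (H.leg₁₂ y) = H.leg₁₂ (H.leg₂₃.symm y) := by
  apply H.leg₂₃.injective
  rw [← leg₁₂_leg₂₃, LinearEquiv.apply_symm_apply, LinearEquiv.apply_symm_apply]

theorem mul'_lTensor_assoc (z : A ⊗[ℂ] A) (c : A) :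
    (LinearMap.mul' ℂ A).lTensor A (TensorProduct.assoc ℂ A A A (z ⊗ₜ c))
      = (LinearMap.mulRight ℂ c).lTensor A z := by
  induction z with
  | zero => simp
  | add x y hx hy => simp only [TensorProduct.add_tmul, map_add, hx, hy]
  | tmul a b => simp

theorem mul'_rTensor_assoc (a : A) (z : A ⊗[ℂ] A) :
    (LinearMap.mul' ℂ A).rTensor A ((TensorProduct.assoc ℂ A A A).symm (a ⊗ₜ z))
      = (LinearMap.mulLeft ℂ a).rTensor A z := by
  induction z with
  | zero => simp
  | add x y hx hy => simp only [TensorProduct.tmul_add, map_add, hx, hy]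
  | tmul b c => simp

theorem mul'_lTensor_leg₁₂ (a : A) (z : A ⊗[ℂ] A) :
    (LinearMap.mul' ℂ A).lTensor A (H.leg₁₂ (a ⊗ₜ z))
      = (LinearMap.mulLeft ℂ a).rTensor A (H.T₁ z) := by
  induction z with
  | zero => simp
  | add x y hx hy => simp only [TensorProduct.tmul_add, map_add, hx, hy]
  | tmul b c => rw [leg₁₂_tmul, mul'_lTensor_assoc, lTensor_T₂]

/-- Multiplying legs 2 and 3 after `leg₁₂` agrees with multiplying legs 1 and 2 after `leg₂₃`, since
both give (a ⊗ 1)Δ(b)(1 ⊗ c). Undoing both operators, which commute, yields the identity. As x and c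
are free, it forces both products to be scalar multiples of c and x, with a common scalar ε(b). -/
theorem tmul_mul'_T₁_symm (x b c : A) :
    x ⊗ₜ[ℂ] LinearMap.mul' ℂ A (H.T₁.symm (b ⊗ₜ c))
      = LinearMap.mul' ℂ A (H.T₂.symm (x ⊗ₜ b)) ⊗ₜ[ℂ] c := by
  have key : ∀ y, (LinearMap.mul' ℂ A).lTensor A (H.leg₁₂ y)
      = (LinearMap.mul' ℂ A).rTensor A ((TensorProduct.assoc ℂ A A A).symm (H.leg₂₃ y)) := by
    intro y
    induction y with
    | zero => simp
    | add x y hx hy => simp only [map_add, hx, hy]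
    | tmul a z => rw [mul'_lTensor_leg₁₂, leg₂₃_tmul, mul'_rTensor_assoc]
  have h := key (H.leg₁₂.symm (H.leg₂₃.symm (x ⊗ₜ (b ⊗ₜ c))))
  rwa [← leg₁₂_symm_leg₂₃, LinearEquiv.apply_symm_apply, LinearEquiv.apply_symm_apply,
    leg₁₂_symm_tmul, leg₂₃_symm_tmul, LinearEquiv.symm_apply_apply, LinearMap.lTensor_tmul,
    LinearMap.rTensor_tmul] at h

theorem isCounit_counit : H.IsCounit H.counit := by
  suffices h : ∃ ε, H.IsCounit ε by
    rw [counit, dif_pos h]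
    exact h.choose_spec
  rcases subsingleton_or_nontrivial A with hA | hA
  · exact ⟨0, fun a b => Subsingleton.elim _ _, fun a b => Subsingleton.elim _ _⟩
  obtain ⟨x, hx⟩ := exists_ne (0 : A)
  obtain ⟨φ, hφ⟩ := Module.Projective.exists_dual_eq_one ℂ hx
  -- The product of `T₂.symm (x ⊗ₜ b)` is to be ε(b)x, and φ with φ(x) = 1 reads off the scalar.
  let ε : A →ₗ[ℂ] ℂ :=
    φ ∘ₗ LinearMap.mul' ℂ A ∘ₗ H.T₂.symm.toLinearMap ∘ₗ TensorProduct.mk ℂ A A x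
  have h₁ : ∀ b c, LinearMap.mul' ℂ A (H.T₁.symm (b ⊗ₜ c)) = ε b • c := by
    intro b c
    have := congrArg ((TensorProduct.lid ℂ A).toLinearMap ∘ₗ φ.rTensor A) (H.tmul_mul'_T₁_symm x b c)
    simpa [hφ, ε] using this
  have h₂ : ∀ a b, LinearMap.mul' ℂ A (H.T₂.symm (a ⊗ₜ b)) = ε b • a := by
    intro a b
    have := congrArg ((TensorProduct.rid ℂ A).toLinearMap ∘ₗ φ.lTensor A) (H.tmul_mul'_T₁_symm a b x)
    rw [h₁] at this
    simpa [hφ] using this.symm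
  refine ⟨ε, fun a b => ?_, fun a b => ?_⟩
  · have key : ∀ z, TensorProduct.lid ℂ A (ε.rTensor A z) = LinearMap.mul' ℂ A (H.T₁.symm z) := by
      intro z
      induction z with
      | zero => simp
      | add x y hx hy => simp only [map_add, hx, hy]
      | tmul b c => simp [h₁]
    rw [key, LinearEquiv.symm_apply_apply, LinearMap.mul'_apply]
  · have key : ∀ z, TensorProduct.rid ℂ A (ε.lTensor A z) = LinearMap.mul' ℂ A (H.T₂.symm z) := by
      intro z
      induction z with
      | zero => simp
      | add x y hx hy => simp only [map_add, hx, hy]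
      | tmul b c => simp [h₂]
    rw [key, LinearEquiv.symm_apply_apply, LinearMap.mul'_apply]

/-- `a ⊗ b ↦ ε(a) b`. -/
def counitLeft : A ⊗[ℂ] A →ₗ[ℂ] A := (TensorProduct.lid ℂ A).toLinearMap ∘ₗ H.counit.rTensor A

/-- `a ⊗ b ↦ ε(b) a`. -/
def counitRight : A ⊗[ℂ] A →ₗ[ℂ] A := (TensorProduct.rid ℂ A).toLinearMap ∘ₗ H.counit.lTensor A

@[simp] theorem counitLeft_tmul (a b : A) : H.counitLeft (a ⊗ₜ b) = H.counit a • b := by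
  simp [counitLeft]

@[simp] theorem counitRight_tmul (a b : A) : H.counitRight (a ⊗ₜ b) = H.counit b • a := by
  simp [counitRight]

theorem counitLeft_comp_T₁ : H.counitLeft ∘ₗ H.T₁.toLinearMap = LinearMap.mul' ℂ A := by
  ext a b
  exact H.isCounit_counit.1 a b

theorem counitRight_comp_T₂ : H.counitRight ∘ₗ H.T₂.toLinearMap = LinearMap.mul' ℂ A := by
  ext a b
  exact H.isCounit_counit.2 a b

theorem counitLeft_T₁ (z : A ⊗[ℂ] A) : H.counitLeft (H.T₁ z) = LinearMap.mul' ℂ A z :=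
  LinearMap.congr_fun H.counitLeft_comp_T₁ z

theorem counitRight_T₂ (z : A ⊗[ℂ] A) : H.counitRight (H.T₂ z) = LinearMap.mul' ℂ A z :=
  LinearMap.congr_fun H.counitRight_comp_T₂ z

theorem counitLeft_comulLeft (a : A) (z : A ⊗[ℂ] A) :
    H.counitLeft (H.comulLeft a z) = a * H.counitLeft z := by
  obtain ⟨w, rfl⟩ := H.T₁.surjective z
  rw [← T₁_mul_left, counitLeft_T₁, counitLeft_T₁]
  induction w with
  | zero => simp
  | add x y hx hy => simp only [map_add, mul_add, hx, hy]
  | tmul x y => simp [_root_.mul_assoc]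

/-- For z = Δ(x)(1 ⊗ y), right multiplication by b ⊗ 1 gives Δ(x)(b ⊗ y), which ε ⊗ ι sends to
ε(b)xy because ε ⊗ ι turns Δ(x) into x. Such z span A ⊗ A. -/
theorem counit_mul (a b : A) : H.counit (a * b) = H.counit a * H.counit b := by
  rcases subsingleton_or_nontrivial A with hA | hA
  · simp [Subsingleton.elim a 0]
  obtain ⟨x, hx⟩ := exists_ne (0 : A)
  have key : ∀ z, H.counitLeft ((LinearMap.mulRight ℂ b).rTensor A z)
      = H.counit b • H.counitLeft z := by
    intro z
    obtain ⟨w, rfl⟩ := H.T₁.surjective z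
    induction w with
    | zero => simp
    | add x y hx hy => simp only [map_add, smul_add, hx, hy]
    | tmul x y =>
      rw [← comulLeft_tmul, counitLeft_comulLeft, counitLeft_T₁, counitLeft_tmul, mul_smul_comm,
        LinearMap.mul'_apply]
  have h := key (a ⊗ₜ x)
  rw [LinearMap.rTensor_tmul, counitLeft_tmul, counitLeft_tmul, smul_smul, mul_comm] at h
  exact smul_left_injective ℂ hx h

/-- If ε were zero, every product ab = (ε ⊗ ι)(Δ(a)(1 ⊗ b)) would vanish, contradicting
non-degeneracy. -/
theorem exists_counit_eq_one [Nontrivial A] : ∃ a, H.counit a = 1 := by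
  by_contra! h
  have h0 : H.counit = 0 := by
    ext a
    by_contra ha
    refine h ((H.counit a)⁻¹ • a) ?_
    rw [map_smul, smul_eq_mul, inv_mul_cancel₀ ha]
  obtain ⟨x, hx⟩ := exists_ne (0 : A)
  refine hx (H.nondeg_left x fun b => ?_)
  rw [← LinearMap.mul'_apply (R := ℂ), ← counitLeft_T₁, counitLeft, h0]
  simp

/-- `a ⊗ b ↦ S(a) b`. -/
def antipodeMulLeft : A ⊗[ℂ] A →ₗ[ℂ] A := H.counitLeft ∘ₗ H.T₁.symm.toLinearMap

/-- `b ⊗ a ↦ b S(a)`. -/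
def antipodeMulRight : A ⊗[ℂ] A →ₗ[ℂ] A := H.counitRight ∘ₗ H.T₂.symm.toLinearMap

theorem antipodeMulLeft_T₁ (z : A ⊗[ℂ] A) : H.antipodeMulLeft (H.T₁ z) = H.counitLeft z := by
  simp [antipodeMulLeft]

theorem antipodeMulRight_T₂ (z : A ⊗[ℂ] A) : H.antipodeMulRight (H.T₂ z) = H.counitRight z := by
  simp [antipodeMulRight]

theorem antipodeMulLeft_comulLeft (a : A) (z : A ⊗[ℂ] A) :
    H.antipodeMulLeft (H.comulLeft a z) = H.counit a • H.antipodeMulLeft z := by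
  obtain ⟨w, rfl⟩ := H.T₁.surjective z
  rw [← T₁_mul_left, antipodeMulLeft_T₁, antipodeMulLeft_T₁]
  induction w with
  | zero => simp
  | add x y hx hy => simp only [map_add, smul_add, hx, hy]
  | tmul x y => simp [counit_mul, smul_smul]

theorem antipodeMulLeft_lTensor (c : A) (z : A ⊗[ℂ] A) :
    H.antipodeMulLeft ((LinearMap.mulRight ℂ c).lTensor A z) = H.antipodeMulLeft z * c := by
  obtain ⟨w, rfl⟩ := H.T₁.surjective z
  rw [← T₁_lTensor, antipodeMulLeft_T₁, antipodeMulLeft_T₁]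
  induction w with
  | zero => simp
  | add x y hx hy => simp only [map_add, add_mul, hx, hy]
  | tmul x y => simp [smul_mul_assoc]

/-- `a ⊗ b ⊗ c ↦ ε(b) a ⊗ c`. -/
def counitMiddle : A ⊗[ℂ] (A ⊗[ℂ] A) →ₗ[ℂ] A ⊗[ℂ] A := H.counitLeft.lTensor A

theorem counitMiddle_eq (y : A ⊗[ℂ] (A ⊗[ℂ] A)) :
    H.counitMiddle y = H.counitRight.rTensor A ((TensorProduct.assoc ℂ A A A).symm y) := by
  induction y with
  | zero => simp
  | add x y hx hy => simp only [map_add, hx, hy]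
  | tmul a z =>
    induction z with
    | zero => simp
    | add x y hx hy => simp only [TensorProduct.tmul_add, map_add, hx, hy]
    | tmul b c => simp [counitMiddle, TensorProduct.smul_tmul']

theorem counitMiddle_leg₂₃ (y : A ⊗[ℂ] (A ⊗[ℂ] A)) :
    H.counitMiddle (H.leg₂₃ y) = (LinearMap.mul' ℂ A).lTensor A y := by
  rw [leg₂₃_apply, counitMiddle, ← LinearMap.lTensor_comp_apply, counitLeft_comp_T₁]

theorem counitMiddle_leg₁₂ (y : A ⊗[ℂ] (A ⊗[ℂ] A)) :
    H.counitMiddle (H.leg₁₂ y)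
      = (LinearMap.mul' ℂ A).rTensor A ((TensorProduct.assoc ℂ A A A).symm y) := by
  rw [counitMiddle_eq, leg₁₂, LinearEquiv.trans_apply, LinearEquiv.trans_apply,
    LinearEquiv.symm_apply_apply, ← counitRight_comp_T₂, LinearMap.rTensor_comp_apply]
  rfl

/-- The covered form of `T₁.symm (a ⊗ₜ b)` = ∑ a₍₁₎ ⊗ S(a₍₂₎)b, obtained by commuting the inverse of
`leg₂₃` past `leg₁₂` and applying ε to the middle leg. Both the twist map and θ are computed from
it. -/
theorem antipodeMulLeft_lTensor_leg₁₂ (c : A) (z : A ⊗[ℂ] A) :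
    H.antipodeMulLeft.lTensor A (H.leg₁₂ (c ⊗ₜ z))
      = (LinearMap.mulLeft ℂ c).rTensor A (H.T₁.symm z) := by
  rw [← mul'_rTensor_assoc, ← leg₂₃_symm_tmul, ← counitMiddle_leg₁₂, ← leg₂₃_symm_leg₁₂,
    antipodeMulLeft, LinearMap.lTensor_comp_apply]
  rfl

/-- The mirror image: `T₂.symm (c ⊗ₜ a)` = ∑ cS(a₍₁₎) ⊗ a₍₂₎, covered on the second leg by b. -/
theorem antipodeMulRight_rTensor_leg₂₃ (c a b : A) :
    H.antipodeMulRight.rTensor A ((TensorProduct.assoc ℂ A A A).symm (c ⊗ₜ H.T₁ (a ⊗ₜ b)))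
      = (LinearMap.mulRight ℂ b).lTensor A (H.T₂.symm (c ⊗ₜ a)) := by
  rw [← mul'_lTensor_assoc, ← leg₁₂_symm_tmul, ← counitMiddle_leg₂₃, ← leg₁₂_symm_leg₂₃,
    antipodeMulRight, LinearMap.rTensor_comp_apply, counitMiddle_eq, leg₂₃_tmul, leg₁₂]
  simp only [LinearEquiv.symm_trans_apply, LinearEquiv.symm_symm, LinearEquiv.symm_apply_apply]
  rfl

/-- The left and right actions attached to a form a multiplier S(a). Multiplying the legs of the
covered formula for `T₂.symm` turns it into the counit property, and `T₁` is then inverted. -/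
theorem antipodeMulRight_mul (a b c : A) :
    H.antipodeMulRight (c ⊗ₜ a) * b = c * H.antipodeMulLeft (a ⊗ₜ b) := by
  have key : ∀ z, LinearMap.mul' ℂ A (H.antipodeMulRight.rTensor A
      ((TensorProduct.assoc ℂ A A A).symm (c ⊗ₜ H.T₁ z))) = c * H.counitLeft z := by
    intro z
    induction z with
    | zero => simp
    | add x y hx hy => simp only [TensorProduct.tmul_add, map_add, mul_add, hx, hy]
    | tmul a b =>
      rw [antipodeMulRight_rTensor_leg₂₃]
      have h : ∀ w : A ⊗[ℂ] A, LinearMap.mul' ℂ A ((LinearMap.mulRight ℂ b).lTensor A w)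
          = LinearMap.mul' ℂ A w * b := by
        intro w
        induction w with
        | zero => simp
        | add x y hx hy => simp only [map_add, add_mul, hx, hy]
        | tmul x y => simp [_root_.mul_assoc]
      rw [h, ← counitRight_T₂, LinearEquiv.apply_symm_apply, counitRight_tmul, counitLeft_tmul,
        smul_mul_assoc, mul_smul_comm]
  have := key (H.T₁.symm (a ⊗ₜ b))
  simpa [antipodeMulLeft] using this

end MultiplierHopfAlgebra

/-! ### The antipode in the regular case. -/

namespace RegularMultiplierHopfAlgebra

variable {A : Type*} [NonUnitalRing A] [Module ℂ A] [SMulCommClass ℂ A A] [IsScalarTower ℂ A A]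
  (H : RegularMultiplierHopfAlgebra A)

theorem cop_comulLeft (a : A) (z : A ⊗[ℂ] A) :
    H.cop.comulLeft a z
      = TensorProduct.comm ℂ A A (H.comulLeft a (TensorProduct.comm ℂ A A z)) := by
  have : H.cop.comul = flipComul H.comul := H.copHopf_comul
  rw [MultiplierHopfAlgebra.comulLeft_apply, this]
  rfl

theorem lTensor_comm {V W U : Type*} [AddCommMonoid V] [Module ℂ V] [AddCommMonoid W] [Module ℂ W]
    [AddCommMonoid U] [Module ℂ U] (f : V →ₗ[ℂ] W) (z : V ⊗[ℂ] U) :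
    f.lTensor U (TensorProduct.comm ℂ V U z) = TensorProduct.comm ℂ W U (f.rTensor U z) := by
  induction z with
  | zero => simp
  | add x y hx hy => simp only [map_add, hx, hy]
  | tmul a b => simp

theorem rTensor_comm {V W U : Type*} [AddCommMonoid V] [Module ℂ V] [AddCommMonoid W] [Module ℂ W]
    [AddCommMonoid U] [Module ℂ U] (f : V →ₗ[ℂ] W) (z : U ⊗[ℂ] V) :
    f.rTensor U (TensorProduct.comm ℂ U V z) = TensorProduct.comm ℂ U W (f.lTensor U z) := by
  induction z with
  | zero => simp
  | add x y hx hy => simp only [map_add, hx, hy]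
  | tmul a b => simp

/-- Regularity is what puts S(a) in A rather than in M(A): then Δ(e)(a ⊗ 1) lies in A ⊗ A. Since m(S
⊗ ι)(Δ(e)(a ⊗ b)) = ε(e)S(a)b, an e with ε(e) = 1 recovers S(a) as m(S ⊗ ι)(Δ(e)(a ⊗ 1)). -/
theorem exists_antipode : ∃ S : A →ₗ[ℂ] A, ∀ a b, S a * b = H.antipodeMulLeft (a ⊗ₜ b) := by
  rcases subsingleton_or_nontrivial A with hA | hA
  · exact ⟨0, fun a b => Subsingleton.elim _ _⟩
  obtain ⟨e, he⟩ := H.exists_counit_eq_one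
  refine ⟨H.antipodeMulLeft ∘ₗ (TensorProduct.comm ℂ A A).toLinearMap ∘ₗ H.cop.T₁.toLinearMap ∘ₗ
    TensorProduct.mk ℂ A A e, fun a b => ?_⟩
  simp only [LinearMap.comp_apply, LinearEquiv.coe_coe, TensorProduct.mk_apply]
  rw [← MultiplierHopfAlgebra.antipodeMulLeft_lTensor, lTensor_comm,
    ← MultiplierHopfAlgebra.comulLeft_tmul, cop_comulLeft, TensorProduct.comm_comm,
    TensorProduct.comm_tmul, MultiplierHopfAlgebra.antipodeMulLeft_comulLeft, he, one_smul]

theorem isAntipode_antipode : H.IsAntipode H.antipode := by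
  suffices h : ∃ S, H.IsAntipode S by
    rw [MultiplierHopfAlgebra.antipode, dif_pos h]
    exact h.choose_spec
  obtain ⟨S, hS⟩ := H.exists_antipode
  have hS' : ∀ a b, b * S a = H.antipodeMulRight (b ⊗ₜ a) := by
    intro a b
    apply H.ext_right
    intro c
    rw [H.antipodeMulRight_mul, _root_.mul_assoc, hS]
  refine ⟨S, fun a b => ?_, fun a b => ?_⟩
  · have : LinearMap.mul' ℂ A ∘ₗ S.rTensor A = H.antipodeMulLeft := by
      ext a b
      simp [hS]
    rw [← LinearMap.comp_apply (LinearMap.mul' ℂ A), this, H.antipodeMulLeft_T₁, H.counitLeft_tmul]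
  · have : LinearMap.mul' ℂ A ∘ₗ S.lTensor A = H.antipodeMulRight := by
      ext a b
      simp [hS']
    rw [← LinearMap.comp_apply (LinearMap.mul' ℂ A), this, H.antipodeMulRight_T₂,
      H.counitRight_tmul]

theorem mul'_comp_antipode_rTensor :
    LinearMap.mul' ℂ A ∘ₗ H.antipode.rTensor A = H.antipodeMulLeft := by
  have : LinearMap.mul' ℂ A ∘ₗ H.antipode.rTensor A ∘ₗ H.T₁.toLinearMap = H.counitLeft := by
    ext a b
    simpa using H.isAntipode_antipode.1 a b
  rw [MultiplierHopfAlgebra.antipodeMulLeft, ← this]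
  ext a b
  simp

theorem mul'_comp_antipode_lTensor :
    LinearMap.mul' ℂ A ∘ₗ H.antipode.lTensor A = H.antipodeMulRight := by
  have : LinearMap.mul' ℂ A ∘ₗ H.antipode.lTensor A ∘ₗ H.T₂.toLinearMap = H.counitRight := by
    ext a b
    simpa using H.isAntipode_antipode.2 a b
  rw [MultiplierHopfAlgebra.antipodeMulRight, ← this]
  ext a b
  simp

theorem antipodeMulLeft_tmul (a b : A) : H.antipodeMulLeft (a ⊗ₜ b) = H.antipode a * b := by
  rw [← mul'_comp_antipode_rTensor]
  simp

theorem antipodeMulRight_tmul (a b : A) : H.antipodeMulRight (b ⊗ₜ a) = b * H.antipode a := by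
  rw [← mul'_comp_antipode_lTensor]
  simp

/-- On z = Δ(x)(1 ⊗ y), right multiplication by b ⊗ 1 gives Δ(x)(b ⊗ y), which m(S ⊗ ι) sends to
ε(x)S(b)y. So it acts as left multiplication by S(b), and z = a ⊗ c gives the claim. -/
theorem antipode_mul (a b : A) : H.antipode (a * b) = H.antipode b * H.antipode a := by
  have key : ∀ z, H.antipodeMulLeft ((LinearMap.mulRight ℂ b).rTensor A z)
      = H.antipode b * H.antipodeMulLeft z := by
    intro z
    obtain ⟨w, rfl⟩ := H.T₁.surjective z
    induction w with
    | zero => simp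
    | add x y hx hy => simp only [map_add, mul_add, hx, hy]
    | tmul x y =>
      rw [← H.comulLeft_tmul, H.antipodeMulLeft_comulLeft, H.antipodeMulLeft_T₁,
        H.counitLeft_tmul, mul_smul_comm, antipodeMulLeft_tmul]
  apply H.ext_right
  intro c
  have := key (a ⊗ₜ c)
  rwa [LinearMap.rTensor_tmul, LinearMap.mulRight_apply, antipodeMulLeft_tmul,
    antipodeMulLeft_tmul, ← _root_.mul_assoc] at this

end RegularMultiplierHopfAlgebra

/-! ### The smash product and θ through `T₁`. -/

theorem onMiddle_tmul {U V U' V' P Q : Type*} [AddCommMonoid P] [Module ℂ P] [AddCommMonoid Q]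
    [Module ℂ Q] [AddCommMonoid U] [Module ℂ U] [AddCommMonoid V] [Module ℂ V]
    [AddCommMonoid U'] [Module ℂ U'] [AddCommMonoid V'] [Module ℂ V']
    (f : U ⊗[ℂ] V →ₗ[ℂ] U' ⊗[ℂ] V') (p : P) (u : U) (v : V) (q : Q) :
    onMiddle f ((p ⊗ₜ u) ⊗ₜ (v ⊗ₜ q))
      = TensorProduct.map (TensorProduct.mk ℂ P U' p) ((TensorProduct.mk ℂ V' Q).flip q)
          (f (u ⊗ₜ v)) := by
  simp only [onMiddle, LinearMap.comp_apply, LinearEquiv.coe_coe, TensorProduct.assoc_tmul,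
    LinearMap.lTensor_tmul, TensorProduct.assoc_symm_tmul, LinearMap.rTensor_tmul]
  induction f (u ⊗ₜ v) with
  | zero => simp
  | add x y hx hy => simp only [TensorProduct.add_tmul, TensorProduct.tmul_add, map_add, hx, hy]
  | tmul x y => simp

namespace MultiplierHopfAlgebra

variable {A : Type*} [NonUnitalRing A] [Module ℂ A] [SMulCommClass ℂ A A] [IsScalarTower ℂ A A]
  (H : MultiplierHopfAlgebra A)

theorem leg₁₂_lTensor (p : A) (f : A →ₗ[ℂ] A) (z : A ⊗[ℂ] A) :
    H.leg₁₂ (p ⊗ₜ f.lTensor A z) = (f.lTensor A).lTensor A (H.leg₁₂ (p ⊗ₜ z)) := by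
  induction z with
  | zero => simp
  | add x y hx hy => simp only [TensorProduct.tmul_add, map_add, hx, hy]
  | tmul b c =>
    rw [LinearMap.lTensor_tmul, leg₁₂_tmul, leg₁₂_tmul]
    induction H.T₂ (p ⊗ₜ b) with
    | zero => simp
    | add x y hx hy => simp only [TensorProduct.add_tmul, map_add, hx, hy]
    | tmul x y => simp

theorem ext_third (H : MultiplierHopfAlgebra A) {y y' : A ⊗[ℂ] (A ⊗[ℂ] A)}
    (h : ∀ c : A, ((LinearMap.mulRight ℂ c).lTensor A).lTensor A y
      = ((LinearMap.mulRight ℂ c).lTensor A).lTensor A y') : y = y' := by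
  refine lTensor_jointly_injective (fun c : A => (LinearMap.mulRight ℂ c).lTensor A) ?_ h
  intro w hw
  apply H.lTensor_ext_right
  intro c
  rw [hw, map_zero]

end MultiplierHopfAlgebra

namespace RegularMultiplierHopfAlgebra

variable {A : Type*} [NonUnitalRing A] [Module ℂ A] [SMulCommClass ℂ A A] [IsScalarTower ℂ A A]
  (H : RegularMultiplierHopfAlgebra A)

theorem T₄_mul (b a : A) (z : A ⊗[ℂ] A) :
    H.T₄ (b ⊗ₜ a) * z = (LinearMap.mulLeft ℂ b).lTensor A (H.comulLeft a z) := by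
  apply (TensorProduct.comm ℂ A A).injective
  rw [tensorComm_mul, T₄]
  simp only [LinearMap.comp_apply, LinearEquiv.coe_coe, TensorProduct.comm_comm]
  rw [H.cop.T₂_mul, cop_comulLeft, rTensor_comm, TensorProduct.comm_comm]

theorem lTensor_T₄ (b a c : A) :
    (LinearMap.mulRight ℂ c).lTensor A (H.T₄ (b ⊗ₜ a))
      = (LinearMap.mulLeft ℂ b).lTensor A (H.T₁ (a ⊗ₜ c)) := by
  apply H.rTensor_ext_right
  intro u
  rw [rTensor_mulRight_lTensor_mulRight, T₄_mul, H.comulLeft_tmul]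
  rw [← LinearMap.comp_apply, LinearMap.lTensor_comp_rTensor, ← LinearMap.rTensor_comp_lTensor,
    LinearMap.comp_apply]

/-- Coassociativity with b covering from the left. A further factor c on the right of the third leg
replaces `T₄` by `T₁`, and is cancelled afterwards. -/
theorem leg₁₂_T₄ (p b a : A) :
    H.leg₁₂ (p ⊗ₜ H.T₄ (b ⊗ₜ a))
      = (H.T₄ ∘ₗ TensorProduct.mk ℂ A A b).lTensor A (H.T₂ (p ⊗ₜ a)) := by
  apply H.ext_third
  intro c
  rw [← H.leg₁₂_lTensor, lTensor_T₄, H.leg₁₂_lTensor, ← H.leg₂₃_tmul, H.leg₁₂_leg₂₃, H.leg₁₂_tmul]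
  induction H.T₂ (p ⊗ₜ a) with
  | zero => simp
  | add x y hx hy => simp only [TensorProduct.add_tmul, map_add, hx, hy]
  | tmul x y =>
    rw [TensorProduct.assoc_tmul, H.leg₂₃_tmul, LinearMap.lTensor_tmul, LinearMap.lTensor_tmul,
      LinearMap.lTensor_tmul, LinearMap.comp_apply, TensorProduct.mk_apply, lTensor_T₄]

theorem adjointAction_apply (b : A) :
    H.adjointAction b = H.antipodeMulLeft ∘ₗ H.T₄ ∘ₗ TensorProduct.mk ℂ A A b := by
  rw [← mul'_comp_antipode_rTensor]
  rfl

/-- The commutation rule (1 ⊗ b)Δ(a) = ∑ Δ(a₍₁₎)(1 ⊗ (b ◁ a₍₂₎)), solved for the twist by inverting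
`T₁`. -/
theorem isSmashTwist_T₁_symm_T₄ :
    IsSmashTwist H.toMultiplierHopfAlgebra H.adjointAction (H.T₁.symm.toLinearMap ∘ₗ H.T₄) := by
  intro p b a
  rw [LinearMap.comp_apply, LinearEquiv.coe_coe, ← H.antipodeMulLeft_lTensor_leg₁₂, leg₁₂_T₄,
    adjointAction_apply, LinearMap.lTensor_comp_apply A H.antipodeMulLeft]

theorem isSmashTwist_smashTwist :
    IsSmashTwist H.toMultiplierHopfAlgebra H.adjointAction
      (smashTwist H.toMultiplierHopfAlgebra H.adjointAction) := by
  have h : ∃ R, IsSmashTwist H.toMultiplierHopfAlgebra H.adjointAction R :=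
    ⟨_, H.isSmashTwist_T₁_symm_T₄⟩
  rw [smashTwist, dif_pos h]
  exact h.choose_spec

theorem smashTwist_eq :
    smashTwist H.toMultiplierHopfAlgebra H.adjointAction = H.T₁.symm.toLinearMap ∘ₗ H.T₄ := by
  ext b a
  apply H.rTensor_ext_left
  intro p
  exact (H.isSmashTwist_smashTwist p b a).trans (H.isSmashTwist_T₁_symm_T₄ p b a).symm

theorem T₁_smashTwist (z : A ⊗[ℂ] A) :
    H.T₁ (smashTwist H.toMultiplierHopfAlgebra H.adjointAction z) = H.T₄ z := by
  rw [smashTwist_eq]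
  simp

/-- In Δ(a)(1 ⊗ b)Δ(a')(1 ⊗ b') the middle factor (1 ⊗ b)Δ(a') is `T₁` of the twist. The outer
factors pass through `T₁`, which intertwines a on the first leg with Δ(a) and commutes with right
multiplication on the second. -/
theorem T₁_mulMap (x y : A ⊗[ℂ] A) :
    H.T₁ (SmashProduct.mulMap H.toMultiplierHopfAlgebra H.adjointAction (x ⊗ₜ y))
      = H.T₁ x * H.T₁ y := by
  induction x with
  | zero => simp
  | add x y hx hy => simp only [TensorProduct.add_tmul, map_add, add_mul, hx, hy]
  | tmul a b =>
    induction y with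
    | zero => simp
    | add x y hx hy => simp only [TensorProduct.tmul_add, map_add, mul_add, hx, hy]
    | tmul a' b' =>
      have h : ∀ t : A ⊗[ℂ] A, TensorProduct.map (LinearMap.mul' ℂ A) (LinearMap.mul' ℂ A)
          (TensorProduct.map (TensorProduct.mk ℂ A A a) ((TensorProduct.mk ℂ A A).flip b') t)
          = (LinearMap.mulLeft ℂ a).rTensor A ((LinearMap.mulRight ℂ b').lTensor A t) := by
        intro t
        induction t with
        | zero => simp
        | add x y hx hy => simp only [map_add, hx, hy]
        | tmul x y => simp
      rw [SmashProduct.mulMap, LinearMap.comp_apply, onMiddle_tmul, h, H.T₁_mul_left, H.T₁_lTensor,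
        T₁_smashTwist, lTensor_T₄, H.T₁_mul]

/-- The isomorphism `θ`, the inverse of `T₁`. -/
def theta : A ⊗[ℂ] A ≃ₗ[ℂ] SmashProduct H.toMultiplierHopfAlgebra H.adjointAction :=
  H.T₁.symm ≪≫ₗ SmashProduct.ofTensor _ _

theorem theta_mul (x y : A ⊗[ℂ] A) : H.theta (x * y) = H.theta x * H.theta y := by
  apply H.theta.symm.injective
  rw [SmashProduct.mul_def, LinearEquiv.symm_apply_apply]
  simp only [theta, LinearEquiv.trans_apply, LinearEquiv.symm_trans_apply,
    LinearEquiv.symm_apply_apply, LinearEquiv.symm_symm, T₁_mulMap, LinearEquiv.apply_symm_apply]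

theorem isTheta_theta : H.IsTheta H.theta.toLinearMap := by
  intro p a b
  simp only [theta, LinearEquiv.coe_coe, LinearEquiv.trans_apply, LinearEquiv.symm_apply_apply]
  rw [← H.antipodeMulLeft_lTensor_leg₁₂, H.leg₁₂_tmul]
  induction H.T₂ (p ⊗ₜ a) with
  | zero => simp
  | add x y hx hy => simp only [TensorProduct.add_tmul, map_add, hx, hy]
  | tmul x y => simp [antipodeMulLeft_tmul]

end RegularMultiplierHopfAlgebra

/-! ### Conjugation and tensor products of multipliers. -/

section Congr

variable {X Y Z W : Type*}
  [NonUnitalNonAssocSemiring X] [Module ℂ X] [SMulCommClass ℂ X X] [IsScalarTower ℂ X X]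
  [NonUnitalNonAssocSemiring Y] [Module ℂ Y] [SMulCommClass ℂ Y Y] [IsScalarTower ℂ Y Y]
  [NonUnitalNonAssocSemiring Z] [Module ℂ Z] [SMulCommClass ℂ Z Z] [IsScalarTower ℂ Z Z]
  [NonUnitalNonAssocSemiring W] [Module ℂ W] [SMulCommClass ℂ W W] [IsScalarTower ℂ W W]

/-- Conjugation of a pair of operators with a linear isomorphism. -/
def BiOp.congr (e : X ≃ₗ[ℂ] Y) (m : BiOp X) : BiOp Y :=
  (e.toLinearMap ∘ₗ m.1 ∘ₗ e.symm.toLinearMap,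
    MulOpposite.op (e.toLinearMap ∘ₗ m.2.unop ∘ₗ e.symm.toLinearMap))

theorem BiOp.ext' {m n : BiOp X} (h₁ : ∀ x, m.1 x = n.1 x) (h₂ : ∀ x, m.2.unop x = n.2.unop x) :
    m = n :=
  Prod.ext (LinearMap.ext h₁) (MulOpposite.unop_injective (LinearMap.ext h₂))

theorem BiOp.congr_mul (e : X ≃ₗ[ℂ] Y) (m n : BiOp X) :
    BiOp.congr e (m * n) = BiOp.congr e m * BiOp.congr e n := by
  apply BiOp.ext' <;> intro x <;> simp [BiOp.congr]

theorem BiOp.congr_one (e : X ≃ₗ[ℂ] Y) : BiOp.congr e 1 = 1 := by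
  apply BiOp.ext' <;> intro x <;> simp [BiOp.congr]

theorem BiOp.congr_ofElem (e : X ≃ₗ[ℂ] Y) (he : ∀ x x', e (x * x') = e x * e x') (x : X) :
    BiOp.congr e (BiOp.ofElem x) = BiOp.ofElem (e x) := by
  apply BiOp.ext' <;> intro y <;> simp [BiOp.congr, BiOp.ofElem, he]

theorem BiOp.tensor_congr (e : X ≃ₗ[ℂ] Z) (f : Y ≃ₗ[ℂ] W) (m : BiOp X) (n : BiOp Y) :
    BiOp.tensor (BiOp.congr e m) (BiOp.congr f n)
      = BiOp.congr (TensorProduct.congr e f) (BiOp.tensor m n) := by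
  apply BiOp.ext' <;> intro x
  all_goals
    induction x with
    | zero => simp
    | add x y hx hy => simp only [map_add, hx, hy]
    | tmul x y => simp [BiOp.congr, BiOp.tensor]

theorem BiOp.tensor_mul (m m' : BiOp X) (n n' : BiOp Y) :
    BiOp.tensor (m * m') (n * n') = BiOp.tensor m n * BiOp.tensor m' n' := by
  apply BiOp.ext' <;> intro x
  all_goals
    induction x with
    | zero => simp
    | add x y hx hy => simp only [map_add, hx, hy]
    | tmul x y => simp [BiOp.tensor]

theorem BiOp.tensor_one_one : BiOp.tensor (1 : BiOp X) (1 : BiOp Y) = 1 := by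
  apply BiOp.ext' <;> intro x
  all_goals
    induction x with
    | zero => simp
    | add x y hx hy => simp only [map_add, hx, hy]
    | tmul x y => simp [BiOp.tensor]

theorem BiOp.tensor_ofElem (x : X) (y : Y) :
    BiOp.tensor (BiOp.ofElem x) (BiOp.ofElem y) = BiOp.ofElem (x ⊗ₜ[ℂ] y) := by
  apply BiOp.ext' <;> intro x
  all_goals
    induction x with
    | zero => simp
    | add x y hx hy => simp only [map_add, hx, hy]
    | tmul x y => simp [BiOp.tensor, BiOp.ofElem]

theorem BiOp.congr_congr (e : X ≃ₗ[ℂ] Y) (f : Y ≃ₗ[ℂ] Z) (m : BiOp X) :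
    BiOp.congr f (BiOp.congr e m) = BiOp.congr (e ≪≫ₗ f) m := rfl

theorem BiOp.ofElem_zero : BiOp.ofElem (0 : X) = 0 := by
  apply BiOp.ext' <;> intro x <;> simp [BiOp.ofElem]

theorem BiOp.ofElem_add (x y : X) : BiOp.ofElem (x + y) = BiOp.ofElem x + BiOp.ofElem y := by
  apply BiOp.ext' <;> intro z <;> simp [BiOp.ofElem, add_mul, mul_add]

theorem BiOp.tensor_zero_left (n : BiOp Y) : BiOp.tensor (0 : BiOp X) n = 0 := by
  apply BiOp.ext' <;> intro z <;> simp [BiOp.tensor, TensorProduct.map_zero_left]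

theorem BiOp.tensor_zero_right (m : BiOp X) : BiOp.tensor m (0 : BiOp Y) = 0 := by
  apply BiOp.ext' <;> intro z <;> simp [BiOp.tensor, TensorProduct.map_zero_right]

theorem BiOp.tensor_add_left (m m' : BiOp X) (n : BiOp Y) :
    BiOp.tensor (m + m') n = BiOp.tensor m n + BiOp.tensor m' n := by
  apply BiOp.ext' <;> intro z <;> simp [BiOp.tensor, TensorProduct.map_add_left]

theorem BiOp.tensor_add_right (m : BiOp X) (n n' : BiOp Y) :
    BiOp.tensor m (n + n') = BiOp.tensor m n + BiOp.tensor m n' := by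
  apply BiOp.ext' <;> intro z <;> simp [BiOp.tensor, TensorProduct.map_add_right]

theorem Multiplier.congr_mul (e : X ≃ₗ[ℂ] Y) (he : ∀ x x', e (x * x') = e x * e x')
    (m n : Multiplier X) :
    Multiplier.congr e he (m * n) = Multiplier.congr e he m * Multiplier.congr e he n :=
  Subtype.ext (BiOp.congr_mul e m n)

theorem Multiplier.tensor_mul (m m' : Multiplier X) (n n' : Multiplier Y) :
    Multiplier.tensor (m * m') (n * n') = Multiplier.tensor m n * Multiplier.tensor m' n' :=
  Subtype.ext (BiOp.tensor_mul _ _ _ _)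

end Congr

/-! ### Transport of structure along an algebra isomorphism. -/

section Transport

variable {X Y : Type*}
  [NonUnitalNonAssocSemiring X] [Module ℂ X] [SMulCommClass ℂ X X] [IsScalarTower ℂ X X]
  [NonUnitalNonAssocSemiring Y] [Module ℂ Y] [SMulCommClass ℂ Y Y] [IsScalarTower ℂ Y Y]

/-- Transport of a coproduct along an isomorphism of algebras. -/
def transportComul (Δ : X →ₗ[ℂ] Multiplier (X ⊗[ℂ] X)) (e : X ≃ₗ[ℂ] Y)
    (he : ∀ x x', e (x * x') = e x * e x') : Y →ₗ[ℂ] Multiplier (Y ⊗[ℂ] Y) :=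
  Multiplier.congr (TensorProduct.congr e e) (tensorCongr_mul e e he he) ∘ₗ Δ ∘ₗ e.symm.toLinearMap

theorem coe_transportComul (Δ : X →ₗ[ℂ] Multiplier (X ⊗[ℂ] X)) (e : X ≃ₗ[ℂ] Y)
    (he : ∀ x x', e (x * x') = e x * e x') (y : Y) :
    (transportComul Δ e he y : BiOp (Y ⊗[ℂ] Y))
      = BiOp.congr (TensorProduct.congr e e) (Δ (e.symm y)) := rfl

/-- Transport of a multiplier Hopf algebra along an isomorphism of algebras. -/
def MultiplierHopfAlgebra.transport (H : MultiplierHopfAlgebra X) (e : X ≃ₗ[ℂ] Y)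
    (he : ∀ x x', e (x * x') = e x * e x') : MultiplierHopfAlgebra Y where
  mul_assoc a b c := by
    obtain ⟨a, rfl⟩ := e.surjective a
    obtain ⟨b, rfl⟩ := e.surjective b
    obtain ⟨c, rfl⟩ := e.surjective c
    rw [← he, ← he, ← he, ← he, H.mul_assoc]
  nondeg_left a h := by
    obtain ⟨a, rfl⟩ := e.surjective a
    rw [H.nondeg_left a, map_zero]
    intro b
    apply e.injective
    rw [he, h, map_zero]
  nondeg_right a h := by
    obtain ⟨a, rfl⟩ := e.surjective a
    rw [H.nondeg_right a, map_zero]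
    intro b
    apply e.injective
    rw [he, h, map_zero]
  comul := transportComul H.comul e he
  comul_mul a b := by
    obtain ⟨a, rfl⟩ := e.surjective a
    obtain ⟨b, rfl⟩ := e.surjective b
    rw [← he]
    simp only [transportComul, LinearMap.comp_apply, LinearEquiv.coe_coe,
      LinearEquiv.symm_apply_apply, H.comul_mul, Multiplier.congr_mul]
  T₁ := (TensorProduct.congr e e).symm ≪≫ₗ H.T₁ ≪≫ₗ TensorProduct.congr e e
  T₂ := (TensorProduct.congr e e).symm ≪≫ₗ H.T₂ ≪≫ₗ TensorProduct.congr e e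
  T₁_spec a b := by
    obtain ⟨b, rfl⟩ := e.surjective b
    rw [coe_transportComul, ← BiOp.congr_ofElem e he, ← BiOp.congr_one e, BiOp.tensor_congr,
      ← BiOp.congr_mul, H.T₁_spec, BiOp.congr_ofElem _ (tensorCongr_mul e e he he)]
    simp
  T₂_spec a b := by
    obtain ⟨a, rfl⟩ := e.surjective a
    rw [coe_transportComul, ← BiOp.congr_ofElem e he, ← BiOp.congr_one e, BiOp.tensor_congr,
      ← BiOp.congr_mul, H.T₂_spec, BiOp.congr_ofElem _ (tensorCongr_mul e e he he)]
    simp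
  coassoc a b c := by
    obtain ⟨a, rfl⟩ := e.surjective a
    obtain ⟨b, rfl⟩ := e.surjective b
    obtain ⟨c, rfl⟩ := e.surjective c
    have h := congrArg (TensorProduct.congr e (TensorProduct.congr e e)) (H.coassoc a b c)
    simp only [LinearEquiv.trans_apply, TensorProduct.congr_symm_tmul,
      LinearEquiv.symm_apply_apply]
    have h₁ : ∀ t : X ⊗[ℂ] X, TensorProduct.assoc ℂ Y Y Y
        (((TensorProduct.congr e e).symm ≪≫ₗ H.T₂ ≪≫ₗ TensorProduct.congr e e).toLinearMap.rTensor Y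
          ((TensorProduct.assoc ℂ Y Y Y).symm (e a ⊗ₜ TensorProduct.congr e e t)))
        = TensorProduct.congr e (TensorProduct.congr e e) (TensorProduct.assoc ℂ X X X
          (H.T₂.toLinearMap.rTensor X ((TensorProduct.assoc ℂ X X X).symm (a ⊗ₜ t)))) := by
      intro t
      induction t with
      | zero => simp
      | add x y hx hy => simp only [TensorProduct.tmul_add, map_add, hx, hy]
      | tmul x y =>
        simp only [TensorProduct.congr_tmul, TensorProduct.assoc_symm_tmul, LinearMap.rTensor_tmul,
          LinearEquiv.coe_coe, LinearEquiv.trans_apply, TensorProduct.congr_symm_tmul,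
          LinearEquiv.symm_apply_apply]
        induction H.T₂ (a ⊗ₜ x) with
        | zero => simp
        | add x y hx hy => simp only [TensorProduct.add_tmul, map_add, hx, hy]
        | tmul x y => simp
    have h₂ : ∀ t : X ⊗[ℂ] X,
        ((TensorProduct.congr e e).symm ≪≫ₗ H.T₁ ≪≫ₗ TensorProduct.congr e e).toLinearMap.lTensor Y
          (TensorProduct.assoc ℂ Y Y Y (TensorProduct.congr e e t ⊗ₜ e c))
        = TensorProduct.congr e (TensorProduct.congr e e)
          (H.T₁.toLinearMap.lTensor X (TensorProduct.assoc ℂ X X X (t ⊗ₜ c))) := by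
      intro t
      induction t with
      | zero => simp
      | add x y hx hy => simp only [TensorProduct.add_tmul, map_add, hx, hy]
      | tmul x y => simp
    rw [h₁, h₂, h]

theorem flipComul_transportComul (Δ : X →ₗ[ℂ] Multiplier (X ⊗[ℂ] X)) (e : X ≃ₗ[ℂ] Y)
    (he : ∀ x x', e (x * x') = e x * e x') :
    flipComul (transportComul Δ e he) = transportComul (flipComul Δ) e he := by
  ext1 y
  apply Subtype.ext
  have h : TensorProduct.congr e e ≪≫ₗ TensorProduct.comm ℂ Y Y
      = TensorProduct.comm ℂ X X ≪≫ₗ TensorProduct.congr e e := by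
    apply LinearEquiv.toLinearMap_injective
    apply TensorProduct.ext'
    intro x y
    simp
  change BiOp.congr (TensorProduct.comm ℂ Y Y)
      (BiOp.congr (TensorProduct.congr e e) (Δ (e.symm y)))
    = BiOp.congr (TensorProduct.congr e e) (BiOp.congr (TensorProduct.comm ℂ X X) (Δ (e.symm y)))
  rw [BiOp.congr_congr, BiOp.congr_congr, h]

/-- Transport of a regular multiplier Hopf algebra along an isomorphism of algebras. -/
def RegularMultiplierHopfAlgebra.transport (H : RegularMultiplierHopfAlgebra X) (e : X ≃ₗ[ℂ] Y)
    (he : ∀ x x', e (x * x') = e x * e x') : RegularMultiplierHopfAlgebra Y :=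
  { H.toMultiplierHopfAlgebra.transport e he with
    copHopf := H.copHopf.transport e he
    copHopf_comul := by
      change transportComul H.copHopf.comul e he = flipComul (transportComul H.comul e he)
      rw [H.copHopf_comul, flipComul_transportComul] }

theorem RegularMultiplierHopfAlgebra.transport_comul (H : RegularMultiplierHopfAlgebra X)
    (e : X ≃ₗ[ℂ] Y) (he : ∀ x x', e (x * x') = e x * e x') :
    (H.transport e he).comul = transportComul H.comul e he := rfl

theorem MultiplierHopfAlgebra.isIso_transport (H : MultiplierHopfAlgebra X) (e : X ≃ₗ[ℂ] Y)
    (he : ∀ x x', e (x * x') = e x * e x') : H.IsIso (H.transport e he) e := by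
  refine ⟨he, fun a => ?_⟩
  simp [MultiplierHopfAlgebra.transport, transportComul]

end Transport

/-! ### Tensor products of multiplier Hopf algebras. -/

section Tensor

variable {A B : Type*}
  [NonUnitalRing A] [Module ℂ A] [SMulCommClass ℂ A A] [IsScalarTower ℂ A A]
  [NonUnitalRing B] [Module ℂ B] [SMulCommClass ℂ B B] [IsScalarTower ℂ B B]

/-- Shuffling the legs of a tensor product of threefold tensor products. -/
def shuffle₃ : (A ⊗[ℂ] (A ⊗[ℂ] A)) ⊗[ℂ] (B ⊗[ℂ] (B ⊗[ℂ] B)) →ₗ[ℂ]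
    (A ⊗[ℂ] B) ⊗[ℂ] ((A ⊗[ℂ] B) ⊗[ℂ] (A ⊗[ℂ] B)) :=
  (TensorProduct.tensorTensorTensorComm ℂ A A B B).toLinearMap.lTensor (A ⊗[ℂ] B)
    ∘ₗ (TensorProduct.tensorTensorTensorComm ℂ A (A ⊗[ℂ] A) B (B ⊗[ℂ] B)).toLinearMap

/-- The map `(a ⊗ b) ⊗ (a' ⊗ b') ↦ ∑ (p ⊗ q) ⊗ (p' ⊗ q')` where `f(a ⊗ a') = ∑ p ⊗ p'` and
`g(b ⊗ b') = ∑ q ⊗ q'`. -/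
def tensorPair (f : A ⊗[ℂ] A ≃ₗ[ℂ] A ⊗[ℂ] A) (g : B ⊗[ℂ] B ≃ₗ[ℂ] B ⊗[ℂ] B) :
    (A ⊗[ℂ] B) ⊗[ℂ] (A ⊗[ℂ] B) ≃ₗ[ℂ] (A ⊗[ℂ] B) ⊗[ℂ] (A ⊗[ℂ] B) :=
  (TensorProduct.tensorTensorTensorComm ℂ A A B B).symm ≪≫ₗ TensorProduct.congr f g ≪≫ₗ
    TensorProduct.tensorTensorTensorComm ℂ A A B B

theorem tensorPair_tmul (f : A ⊗[ℂ] A ≃ₗ[ℂ] A ⊗[ℂ] A) (g : B ⊗[ℂ] B ≃ₗ[ℂ] B ⊗[ℂ] B)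
    (a a' : A) (b b' : B) :
    tensorPair f g ((a ⊗ₜ b) ⊗ₜ (a' ⊗ₜ b'))
      = TensorProduct.tensorTensorTensorComm ℂ A A B B (f (a ⊗ₜ a') ⊗ₜ g (b ⊗ₜ b')) := by
  simp [tensorPair]

theorem tensorPair_rTensor (f : A ⊗[ℂ] A ≃ₗ[ℂ] A ⊗[ℂ] A) (g : B ⊗[ℂ] B ≃ₗ[ℂ] B ⊗[ℂ] B)
    (a : A) (b : B) (s : A ⊗[ℂ] A) (t : B ⊗[ℂ] B) :
    TensorProduct.assoc ℂ _ _ _ ((tensorPair f g).toLinearMap.rTensor (A ⊗[ℂ] B)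
        ((TensorProduct.assoc ℂ _ _ _).symm
          ((a ⊗ₜ b) ⊗ₜ TensorProduct.tensorTensorTensorComm ℂ A A B B (s ⊗ₜ t))))
      = shuffle₃ ((TensorProduct.assoc ℂ A A A (f.toLinearMap.rTensor A
            ((TensorProduct.assoc ℂ A A A).symm (a ⊗ₜ s))))
          ⊗ₜ (TensorProduct.assoc ℂ B B B (g.toLinearMap.rTensor B
            ((TensorProduct.assoc ℂ B B B).symm (b ⊗ₜ t))))) := by
  induction s with
  | zero => simp
  | add x y hx hy => simp only [TensorProduct.add_tmul, TensorProduct.tmul_add, map_add, hx, hy]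
  | tmul s₁ s₂ =>
    induction t with
    | zero => simp
    | add x y hx hy => simp only [TensorProduct.tmul_add, map_add, hx, hy]
    | tmul t₁ t₂ =>
      simp only [TensorProduct.tensorTensorTensorComm_tmul, TensorProduct.assoc_symm_tmul,
        LinearMap.rTensor_tmul, LinearEquiv.coe_coe, tensorPair_tmul]
      induction f (a ⊗ₜ s₁) with
      | zero => simp
      | add x y hx hy => simp only [TensorProduct.add_tmul, map_add, hx, hy]
      | tmul x₁ x₂ =>
        induction g (b ⊗ₜ t₁) with
        | zero => simp
        | add x y hx hy =>
          simp only [TensorProduct.add_tmul, TensorProduct.tmul_add, map_add, hx, hy]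
        | tmul y₁ y₂ => simp [shuffle₃]

theorem tensorPair_lTensor (f : A ⊗[ℂ] A ≃ₗ[ℂ] A ⊗[ℂ] A) (g : B ⊗[ℂ] B ≃ₗ[ℂ] B ⊗[ℂ] B)
    (a : A) (b : B) (s : A ⊗[ℂ] A) (t : B ⊗[ℂ] B) :
    (tensorPair f g).toLinearMap.lTensor (A ⊗[ℂ] B) (TensorProduct.assoc ℂ _ _ _
        (TensorProduct.tensorTensorTensorComm ℂ A A B B (s ⊗ₜ t) ⊗ₜ (a ⊗ₜ b)))
      = shuffle₃ ((f.toLinearMap.lTensor A (TensorProduct.assoc ℂ A A A (s ⊗ₜ a)))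
          ⊗ₜ (g.toLinearMap.lTensor B (TensorProduct.assoc ℂ B B B (t ⊗ₜ b)))) := by
  induction s with
  | zero => simp
  | add x y hx hy => simp only [TensorProduct.add_tmul, map_add, hx, hy]
  | tmul s₁ s₂ =>
    induction t with
    | zero => simp
    | add x y hx hy => simp only [TensorProduct.add_tmul, TensorProduct.tmul_add, map_add, hx, hy]
    | tmul t₁ t₂ => simp [tensorPair_tmul, shuffle₃]

theorem BiOp.congr_tensorTensorTensorComm (m : BiOp A) (m' : BiOp A) (n n' : BiOp B) :
    BiOp.congr (TensorProduct.tensorTensorTensorComm ℂ A A B B)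
        (BiOp.tensor (BiOp.tensor m m') (BiOp.tensor n n'))
      = BiOp.tensor (BiOp.tensor m n) (BiOp.tensor m' n') := by
  apply BiOp.ext' <;> intro z
  all_goals
    induction z with
    | zero => simp
    | add x y hx hy => simp only [map_add, hx, hy]
    | tmul x y =>
      induction x with
      | zero => simp
      | add x y hx hy => simp only [TensorProduct.add_tmul, map_add, hx, hy]
      | tmul x x' =>
        induction y with
        | zero => simp
        | add x y hx hy => simp only [TensorProduct.tmul_add, map_add, hx, hy]
        | tmul y y' => simp [BiOp.congr, BiOp.tensor]

theorem coe_tensorComul_tmul (ΔA : A →ₗ[ℂ] Multiplier (A ⊗[ℂ] A))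
    (ΔB : B →ₗ[ℂ] Multiplier (B ⊗[ℂ] B)) (a : A) (b : B) :
    (tensorComul ΔA ΔB (a ⊗ₜ b) : BiOp ((A ⊗[ℂ] B) ⊗[ℂ] (A ⊗[ℂ] B)))
      = BiOp.congr (TensorProduct.tensorTensorTensorComm ℂ A A B B)
          (BiOp.tensor (ΔA a : BiOp (A ⊗[ℂ] A)) (ΔB b : BiOp (B ⊗[ℂ] B))) := rfl

/-- The tensor product of two multiplier Hopf algebras. -/
def MultiplierHopfAlgebra.tensor (H : MultiplierHopfAlgebra A) (K : MultiplierHopfAlgebra B) :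
    MultiplierHopfAlgebra (A ⊗[ℂ] B) where
  mul_assoc := tensor_mul_assoc H.mul_assoc K.mul_assoc
  nondeg_left z h := tensor_nondeg_left H.nondeg_left K.nondeg_left fun u v => by
    rw [h, zero_mul]
  nondeg_right z h := tensor_nondeg_right H.nondeg_right K.nondeg_right fun u v => by
    rw [h, mul_zero]
  comul := tensorComul H.comul K.comul
  comul_mul x y := by
    induction x with
    | zero => simp
    | add x y hx hy => simp only [add_mul, map_add, hx, hy]
    | tmul a b =>
      induction y with
      | zero => simp
      | add x y hx hy => simp only [mul_add, map_add, hx, hy]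
      | tmul a' b' =>
        rw [Algebra.TensorProduct.tmul_mul_tmul]
        simp only [tensorComul, LinearMap.comp_apply, TensorProduct.lift.tmul,
          LinearMap.compl₁₂_apply, H.comul_mul, K.comul_mul, Multiplier.tensor_mul,
          Multiplier.congr_mul]
  T₁ := tensorPair H.T₁ K.T₁
  T₂ := tensorPair H.T₂ K.T₂
  T₁_spec x y := by
    induction x with
    | zero => simp [BiOp.ofElem_zero]
    | add x y hx hy =>
      simp only [TensorProduct.add_tmul, map_add, Subalgebra.coe_add, add_mul, BiOp.ofElem_add, hx, hy]
    | tmul a b =>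
      induction y with
      | zero => simp [BiOp.ofElem_zero, BiOp.tensor_zero_right]
      | add x y hx hy =>
        simp only [TensorProduct.tmul_add, map_add, mul_add, BiOp.ofElem_add,
          BiOp.tensor_add_right, hx, hy]
      | tmul a' b' =>
        rw [coe_tensorComul_tmul, ← BiOp.tensor_ofElem, ← BiOp.tensor_one_one,
          ← BiOp.congr_tensorTensorTensorComm, ← BiOp.congr_mul, ← BiOp.tensor_mul, H.T₁_spec,
          K.T₁_spec, BiOp.tensor_ofElem, BiOp.congr_ofElem _ tensorTensorTensorComm_mul,
          tensorPair_tmul]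
  T₂_spec x y := by
    induction x with
    | zero => simp [BiOp.ofElem_zero, BiOp.tensor_zero_left]
    | add x y hx hy =>
      simp only [TensorProduct.add_tmul, map_add, add_mul, BiOp.ofElem_add, BiOp.tensor_add_left, hx, hy]
    | tmul a b =>
      induction y with
      | zero => simp [BiOp.ofElem_zero]
      | add x y hx hy =>
        simp only [TensorProduct.tmul_add, map_add, Subalgebra.coe_add, mul_add, BiOp.ofElem_add, hx, hy]
      | tmul a' b' =>
        rw [coe_tensorComul_tmul, ← BiOp.tensor_ofElem, ← BiOp.tensor_one_one,
          ← BiOp.congr_tensorTensorTensorComm, ← BiOp.congr_mul, ← BiOp.tensor_mul, H.T₂_spec,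
          K.T₂_spec, BiOp.tensor_ofElem, BiOp.congr_ofElem _ tensorTensorTensorComm_mul,
          tensorPair_tmul]
  coassoc x y z := by
    induction x with
    | zero => simp
    | add x y hx hy => simp only [TensorProduct.add_tmul, map_add, hx, hy]
    | tmul a b =>
      induction y with
      | zero => simp
      | add x y hx hy =>
        simp only [TensorProduct.add_tmul, TensorProduct.tmul_add, map_add, hx, hy]
      | tmul a' b' =>
        induction z with
        | zero => simp
        | add x y hx hy => simp only [TensorProduct.tmul_add, map_add, hx, hy]
        | tmul a'' b'' =>
          rw [tensorPair_tmul, tensorPair_tmul, tensorPair_rTensor, tensorPair_lTensor, H.coassoc,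
            K.coassoc]

theorem flipComul_tensorComul (ΔA : A →ₗ[ℂ] Multiplier (A ⊗[ℂ] A))
    (ΔB : B →ₗ[ℂ] Multiplier (B ⊗[ℂ] B)) :
    flipComul (tensorComul ΔA ΔB) = tensorComul (flipComul ΔA) (flipComul ΔB) := by
  apply TensorProduct.ext'
  intro a b
  apply Subtype.ext
  have h : TensorProduct.tensorTensorTensorComm ℂ A A B B ≪≫ₗ
        TensorProduct.comm ℂ (A ⊗[ℂ] B) (A ⊗[ℂ] B)
      = TensorProduct.congr (TensorProduct.comm ℂ A A) (TensorProduct.comm ℂ B B) ≪≫ₗ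
        TensorProduct.tensorTensorTensorComm ℂ A A B B := by
    apply LinearEquiv.toLinearMap_injective
    apply TensorProduct.ext_fourfold'
    intro a a' b b'
    simp
  rw [coe_tensorComul_tmul]
  change BiOp.congr (TensorProduct.comm ℂ (A ⊗[ℂ] B) (A ⊗[ℂ] B))
      (BiOp.congr (TensorProduct.tensorTensorTensorComm ℂ A A B B)
        (BiOp.tensor (ΔA a : BiOp (A ⊗[ℂ] A)) (ΔB b : BiOp (B ⊗[ℂ] B))))
    = BiOp.congr (TensorProduct.tensorTensorTensorComm ℂ A A B B)
      (BiOp.tensor (BiOp.congr (TensorProduct.comm ℂ A A) (ΔA a))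
        (BiOp.congr (TensorProduct.comm ℂ B B) (ΔB b)))
  rw [BiOp.tensor_congr, BiOp.congr_congr, BiOp.congr_congr, h]

/-- The tensor product of two regular multiplier Hopf algebras. -/
def RegularMultiplierHopfAlgebra.tensor (H : RegularMultiplierHopfAlgebra A)
    (K : RegularMultiplierHopfAlgebra B) : RegularMultiplierHopfAlgebra (A ⊗[ℂ] B) :=
  { H.toMultiplierHopfAlgebra.tensor K.toMultiplierHopfAlgebra with
    copHopf := H.copHopf.tensor K.copHopf
    copHopf_comul := by
      change tensorComul H.copHopf.comul K.copHopf.comul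
        = flipComul (tensorComul H.comul K.comul)
      rw [H.copHopf_comul, K.copHopf_comul, flipComul_tensorComul] }

theorem RegularMultiplierHopfAlgebra.tensor_comul (H : RegularMultiplierHopfAlgebra A)
    (K : RegularMultiplierHopfAlgebra B) :
    (H.tensor K).comul = tensorComul H.comul K.comul := rfl

end Tensor

/-! ### The adjoint coaction as a multiplier. -/

namespace RegularMultiplierHopfAlgebra

variable {A : Type*} [NonUnitalRing A] [Module ℂ A] [SMulCommClass ℂ A A] [IsScalarTower ℂ A A]
  (H : RegularMultiplierHopfAlgebra A)

/-- `p ⊗ q ↦ ∑ S(p₍₁₎) q ⊗ p₍₂₎ c`. -/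
def antipodeTwist (c : A) : A ⊗[ℂ] A →ₗ[ℂ] A ⊗[ℂ] A :=
  H.antipodeMulLeft.rTensor A ∘ₗ (TensorProduct.rightComm ℂ A A A).toLinearMap
    ∘ₗ H.T₁.toLinearMap.rTensor A ∘ₗ (TensorProduct.rightComm ℂ A A A).toLinearMap
    ∘ₗ (TensorProduct.mk ℂ (A ⊗[ℂ] A) A).flip c

theorem antipodeTwist_tmul (c p q : A) :
    H.antipodeTwist c (p ⊗ₜ q)
      = (LinearMap.mulRight ℂ q ∘ₗ H.antipode).rTensor A (H.T₁ (p ⊗ₜ c)) := by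
  simp only [antipodeTwist, LinearMap.comp_apply, LinearMap.flip_apply, TensorProduct.mk_apply,
    LinearEquiv.coe_coe, TensorProduct.rightComm_tmul, LinearMap.rTensor_tmul]
  induction H.T₁ (p ⊗ₜ c) with
  | zero => simp
  | add x y hx hy => simp only [TensorProduct.add_tmul, map_add, hx, hy]
  | tmul x y => simp [antipodeMulLeft_tmul]

theorem adjointCoactionMap_tmul (a b c : A) :
    H.adjointCoactionMap ((a ⊗ₜ b) ⊗ₜ c) = H.antipodeTwist c (H.T₁ (a ⊗ₜ b)) := by
  rw [adjointCoactionMap, mul'_comp_antipode_rTensor]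
  rfl

theorem rTensor_antipodeTwist (u c : A) (z : A ⊗[ℂ] A) :
    H.antipodeTwist c ((LinearMap.mulRight ℂ u).lTensor A z)
      = (LinearMap.mulRight ℂ u).rTensor A (H.antipodeTwist c z) := by
  induction z with
  | zero => simp
  | add x y hx hy => simp only [map_add, hx, hy]
  | tmul p q =>
    rw [LinearMap.lTensor_tmul, antipodeTwist_tmul, antipodeTwist_tmul,
      ← LinearMap.rTensor_comp_apply]
    congr 2
    ext x
    simp [_root_.mul_assoc]

/-- With c on the left, cS(p₍₁₎) ⊗ p₍₂₎ is `T₂.symm (c ⊗ₜ p)`. This links the left action of Γ with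
its right action, which is built from the inverse of `T₂`. -/
theorem mulLeft_antipodeTwist (c e p q : A) :
    (LinearMap.mulLeft ℂ c).rTensor A (H.antipodeTwist e (p ⊗ₜ q))
      = (LinearMap.mulRight ℂ q).rTensor A ((LinearMap.mulRight ℂ e).lTensor A
          (H.T₂.symm (c ⊗ₜ p))) := by
  rw [← H.antipodeMulRight_rTensor_leg₂₃, antipodeTwist_tmul]
  induction H.T₁ (p ⊗ₜ e) with
  | zero => simp
  | add x y hx hy => simp only [TensorProduct.tmul_add, map_add, hx, hy]
  | tmul x y => simp [antipodeMulRight_tmul, _root_.mul_assoc]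

/-- The sum ∑ S(p₍₁₎)q ⊗ p₍₂₎ lies in A ⊗ A even without the cover c: write q as a sum of terms
S(d)e, so that S(p₍₁₎)S(d) = S(dp₍₁₎), and (d ⊗ 1)Δ(p) is in A ⊗ A. -/
theorem exists_uncovered_antipodeTwist : ∃ G : A ⊗[ℂ] A →ₗ[ℂ] A ⊗[ℂ] A,
    ∀ z c, (LinearMap.mulRight ℂ c).lTensor A (G z) = H.antipodeTwist c z := by
  rcases subsingleton_or_nontrivial A with hA | hA
  · exact ⟨0, fun z c => Subsingleton.elim _ _⟩
  obtain ⟨a, ha⟩ := H.exists_counit_eq_one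
  let F : A ⊗[ℂ] (A ⊗[ℂ] A) →ₗ[ℂ] A ⊗[ℂ] A :=
    H.antipodeMulLeft.rTensor A ∘ₗ (TensorProduct.rightComm ℂ A A A).toLinearMap
      ∘ₗ H.T₂.toLinearMap.rTensor A ∘ₗ (TensorProduct.comm ℂ A A).toLinearMap.rTensor A
      ∘ₗ (TensorProduct.assoc ℂ A A A).symm.toLinearMap
  have hF : ∀ p d e, F (p ⊗ₜ (d ⊗ₜ e))
      = (LinearMap.mulRight ℂ e ∘ₗ H.antipode).rTensor A (H.T₂ (d ⊗ₜ p)) := by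
    intro p d e
    simp only [F, LinearMap.comp_apply, LinearEquiv.coe_coe, TensorProduct.assoc_symm_tmul,
      LinearMap.rTensor_tmul, TensorProduct.comm_tmul]
    induction H.T₂ (d ⊗ₜ p) with
    | zero => simp
    | add x y hx hy => simp only [TensorProduct.add_tmul, map_add, hx, hy]
    | tmul x y => simp [antipodeMulLeft_tmul]
  have key : ∀ c p t, (LinearMap.mulRight ℂ c).lTensor A (F (p ⊗ₜ t))
      = H.antipodeTwist c (p ⊗ₜ H.antipodeMulLeft t) := by
    intro c p t
    induction t with
    | zero => simp
    | add x y hx hy => simp only [TensorProduct.tmul_add, map_add, hx, hy]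
    | tmul d e =>
      rw [hF, ← LinearMap.comp_apply, LinearMap.lTensor_comp_rTensor,
        ← LinearMap.rTensor_comp_lTensor, LinearMap.comp_apply, H.lTensor_T₂,
        ← LinearMap.rTensor_comp_apply, antipodeTwist_tmul]
      congr 2
      ext x
      simp [antipodeMulLeft_tmul, antipode_mul, _root_.mul_assoc]
  -- The required terms d ⊗ e come from Δ(a)(1 ⊗ q): m(S ⊗ ι) sends it to ε(a)q = q.
  refine ⟨F ∘ₗ (H.T₁.toLinearMap ∘ₗ TensorProduct.mk ℂ A A a).lTensor A, fun z c => ?_⟩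
  induction z with
  | zero => simp
  | add x y hx hy => simp only [map_add, hx, hy]
  | tmul p q =>
    rw [LinearMap.comp_apply, LinearMap.lTensor_tmul, key]
    simp [H.antipodeMulLeft_T₁, ha]

/-- `a ⊗ (c ⊗ d) ↦ ∑ c S(a₍₁₎) a₍₃₎ ⊗ d a₍₂₎`. -/
def adjointCoactionRight : A ⊗[ℂ] (A ⊗[ℂ] A) →ₗ[ℂ] A ⊗[ℂ] A :=
  (LinearMap.mul' ℂ A).rTensor A ∘ₗ (TensorProduct.assoc ℂ A A A).symm.toLinearMap
    ∘ₗ (TensorProduct.comm ℂ A A).toLinearMap.lTensor A ∘ₗ H.T₂.toLinearMap.lTensor A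
    ∘ₗ (TensorProduct.comm ℂ A A).toLinearMap.lTensor A
    ∘ₗ (TensorProduct.assoc ℂ A A A).toLinearMap ∘ₗ H.T₂.symm.toLinearMap.rTensor A
    ∘ₗ (TensorProduct.comm ℂ A A).toLinearMap.rTensor A
    ∘ₗ (TensorProduct.assoc ℂ A A A).symm.toLinearMap

/-- `u ⊗ (x ⊗ y) ↦ u y ⊗ d x e`. -/
def foldMiddle (d e : A) : A ⊗[ℂ] (A ⊗[ℂ] A) →ₗ[ℂ] A ⊗[ℂ] A :=
  (LinearMap.mul' ℂ A).rTensor A ∘ₗ (TensorProduct.assoc ℂ A A A).symm.toLinearMap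
    ∘ₗ ((TensorProduct.comm ℂ A A).toLinearMap
      ∘ₗ (LinearMap.mulLeft ℂ d ∘ₗ LinearMap.mulRight ℂ e).rTensor A).lTensor A

@[simp] theorem foldMiddle_tmul (d e u x y : A) :
    foldMiddle d e (u ⊗ₜ (x ⊗ₜ y)) = (u * y) ⊗ₜ (d * (x * e)) := by
  simp [foldMiddle]

/-- This and `mul_antipodeTwist` bring the two actions to one expression, ∑ cS(a₍₁₎)a₍₃₎b ⊗ da₍₂₎e,
which is the multiplier condition for Γ. -/
theorem adjointCoactionRight_mul (a b c d e : A) :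
    H.adjointCoactionRight (a ⊗ₜ (c ⊗ₜ d)) * (b ⊗ₜ e)
      = foldMiddle d e (H.leg₁₂.symm (c ⊗ₜ H.T₁ (a ⊗ₜ b))) := by
  rw [← H.leg₂₃_tmul, H.leg₁₂_symm_leg₂₃, H.leg₁₂_symm_tmul]
  simp only [adjointCoactionRight, LinearMap.comp_apply, LinearEquiv.coe_coe,
    TensorProduct.assoc_symm_tmul, LinearMap.rTensor_tmul, TensorProduct.comm_tmul]
  induction H.T₂.symm (c ⊗ₜ a) with
  | zero => simp
  | add x y hx hy => simp only [TensorProduct.add_tmul, map_add, add_mul, hx, hy]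
  | tmul u v =>
    simp only [TensorProduct.assoc_tmul, LinearMap.lTensor_tmul, LinearEquiv.coe_coe,
      TensorProduct.comm_tmul, H.leg₂₃_tmul]
    have h₁ : ∀ w : A ⊗[ℂ] A, (LinearMap.mul' ℂ A).rTensor A
        ((TensorProduct.assoc ℂ A A A).symm (u ⊗ₜ TensorProduct.comm ℂ A A w)) * (b ⊗ₜ e)
        = (LinearMap.mulLeft ℂ u).rTensor A (TensorProduct.comm ℂ A A (w * (e ⊗ₜ b))) := by
      intro w
      induction w with
      | zero => simp
      | add x y hx hy => simp only [TensorProduct.tmul_add, map_add, add_mul, hx, hy]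
      | tmul x y => simp [_root_.mul_assoc]
    rw [h₁, H.T₂_mul, H.comulLeft_tmul]
    induction H.T₁ (v ⊗ₜ b) with
    | zero => simp
    | add x y hx hy => simp only [TensorProduct.tmul_add, map_add, hx, hy]
    | tmul x y => simp

theorem mul_antipodeTwist (c d e : A) (z : A ⊗[ℂ] A) :
    (c ⊗ₜ d) * H.antipodeTwist e z = foldMiddle d e (H.leg₁₂.symm (c ⊗ₜ z)) := by
  induction z with
  | zero => simp
  | add x y hx hy => simp only [TensorProduct.tmul_add, map_add, mul_add, hx, hy]
  | tmul p q =>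
    rw [tmul_mul_eq, mulLeft_antipodeTwist, H.leg₁₂_symm_tmul]
    induction H.T₂.symm (c ⊗ₜ p) with
    | zero => simp
    | add x y hx hy => simp only [TensorProduct.add_tmul, map_add, hx, hy]
    | tmul x y => simp

/-- The adjoint coaction `Γ(a) = ∑ S(a₍₁₎) a₍₃₎ ⊗ a₍₂₎`. -/
def adjointCoaction : A →ₗ[ℂ] Multiplier (A ⊗[ℂ] A) where
  toFun a := ⟨(H.adjointCoactionMap ∘ₗ (TensorProduct.assoc ℂ A A A).symm.toLinearMap
        ∘ₗ TensorProduct.mk ℂ A (A ⊗[ℂ] A) a,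
      MulOpposite.op (H.adjointCoactionRight ∘ₗ TensorProduct.mk ℂ A (A ⊗[ℂ] A) a)), by
    intro x y
    induction x with
    | zero => simp
    | add x y hx hy => simp only [map_add, add_mul, hx, hy]
    | tmul c d =>
      induction y with
      | zero => simp
      | add x y hx hy => simp only [map_add, mul_add, hx, hy]
      | tmul b e =>
        simp only [LinearMap.comp_apply, LinearEquiv.coe_coe, TensorProduct.mk_apply,
          TensorProduct.assoc_symm_tmul, MulOpposite.unop_op]
        rw [adjointCoactionRight_mul, adjointCoactionMap_tmul, mul_antipodeTwist]⟩
  map_add' a b := by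
    apply Multiplier.ext' <;> ext <;> simp
  map_smul' r a := by
    apply Multiplier.ext' <;> ext <;> simp

theorem adjointCoaction_apply (a b c : A) :
    (H.adjointCoaction a).1.1 (b ⊗ₜ c) = H.antipodeTwist c (H.T₁ (a ⊗ₜ b)) := by
  rw [← adjointCoactionMap_tmul]
  rfl

theorem isAdjointCoaction_adjointCoaction : H.IsAdjointCoaction H.adjointCoaction := by
  intro a b c
  rw [adjointCoaction_apply, adjointCoactionMap_tmul]

theorem _root_.BiOp.tensor_mem {X Y : Type*}
    [NonUnitalNonAssocSemiring X] [Module ℂ X] [SMulCommClass ℂ X X] [IsScalarTower ℂ X X]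
    [NonUnitalNonAssocSemiring Y] [Module ℂ Y] [SMulCommClass ℂ Y Y] [IsScalarTower ℂ Y Y]
    {m : BiOp X} {n : BiOp Y} (hm : m ∈ multiplierAlgebra X) (hn : n ∈ multiplierAlgebra Y) :
    BiOp.tensor m n ∈ multiplierAlgebra (X ⊗[ℂ] Y) :=
  (Multiplier.tensor ⟨m, hm⟩ ⟨n, hn⟩).2

/-- Supplies the map with values in B ⊗ A that `IsBicrossComul` asks for: Γ(a)(b ⊗ 1) needs no cover
on its second leg. -/
theorem adjointCoaction_mul_tensor {G : A ⊗[ℂ] A →ₗ[ℂ] A ⊗[ℂ] A}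
    (hG : ∀ z c, (LinearMap.mulRight ℂ c).lTensor A (G z) = H.antipodeTwist c z) (a b : A) :
    (H.adjointCoaction a : BiOp (A ⊗[ℂ] A)) * BiOp.tensor (BiOp.ofElem b) 1
      = BiOp.ofElem (G (H.T₁ (a ⊗ₜ b))) := by
  apply Multiplier.ext_left
  · intro x y h
    exact H.tensor_ext_right fun u v => h _
  · exact mul_mem (H.adjointCoaction a).2 (BiOp.tensor_mem (BiOp.ofElem_mem _root_.mul_assoc b) (one_mem _))
  · exact BiOp.ofElem_mem _root_.mul_assoc _
  · apply TensorProduct.ext'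
    intro u c
    change (H.adjointCoaction a).1.1 ((b * u) ⊗ₜ c) = G (H.T₁ (a ⊗ₜ b)) * (u ⊗ₜ c)
    rw [adjointCoaction_apply, ← rTensor_mulRight_lTensor_mulRight, hG, ← rTensor_antipodeTwist,
      ← H.T₁_lTensor, LinearMap.lTensor_tmul, LinearMap.mulRight_apply]

end RegularMultiplierHopfAlgebra

/-! ### Iterated coproducts. -/

namespace MultiplierHopfAlgebra

variable {A : Type*} [NonUnitalRing A] [Module ℂ A] [SMulCommClass ℂ A A] [IsScalarTower ℂ A A]
  (H : MultiplierHopfAlgebra A)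

/-- `w ⊗ l ↦ ∑ a₍₁₎ ⊗ a₍₂₎ w ⊗ a₍₃₎ l`. -/
def comul₃ (a : A) : A ⊗[ℂ] A →ₗ[ℂ] A ⊗[ℂ] (A ⊗[ℂ] A) :=
  (TensorProduct.assoc ℂ A A A).toLinearMap ∘ₗ H.T₁.toLinearMap.rTensor A
    ∘ₗ (TensorProduct.comm ℂ A A).toLinearMap.rTensor A
    ∘ₗ (TensorProduct.assoc ℂ A A A).symm.toLinearMap
    ∘ₗ (H.T₁.toLinearMap ∘ₗ TensorProduct.mk ℂ A A a).lTensor A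

theorem comul₃_tmul (a w l : A) :
    H.comul₃ a (w ⊗ₜ l) = TensorProduct.assoc ℂ A A A
      ((H.T₁.toLinearMap ∘ₗ (TensorProduct.mk ℂ A A).flip w).rTensor A (H.T₁ (a ⊗ₜ l))) := by
  simp only [comul₃, LinearMap.comp_apply, LinearMap.lTensor_tmul, LinearEquiv.coe_coe,
    TensorProduct.mk_apply]
  congr 1
  induction H.T₁ (a ⊗ₜ l) with
  | zero => simp
  | add x y hx hy => simp only [TensorProduct.tmul_add, map_add, hx, hy]
  | tmul x y => simp

theorem mulLeft_comul₃ (c a : A) (z : A ⊗[ℂ] A) :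
    (LinearMap.mulLeft ℂ c).rTensor (A ⊗[ℂ] A) (H.comul₃ a z)
      = (H.comulLeft.flip z).lTensor A (H.T₂ (c ⊗ₜ a)) := by
  induction z with
  | zero => simp
  | add x y hx hy => simp only [map_add, LinearMap.lTensor_add, LinearMap.add_apply, hx, hy]
  | tmul w l =>
    have h₁ : ∀ t : A ⊗[ℂ] A, (LinearMap.mulLeft ℂ c).rTensor (A ⊗[ℂ] A)
        (TensorProduct.assoc ℂ A A A
          ((H.T₁.toLinearMap ∘ₗ (TensorProduct.mk ℂ A A).flip w).rTensor A t))
        = ((LinearMap.mulRight ℂ w).rTensor A).lTensor A (H.leg₁₂ (c ⊗ₜ t)) := by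
      intro t
      induction t with
      | zero => simp
      | add x y hx hy => simp only [TensorProduct.tmul_add, map_add, hx, hy]
      | tmul x y =>
        rw [H.leg₁₂_tmul]
        have h₂ : ∀ s : A ⊗[ℂ] A, ((LinearMap.mulRight ℂ w).rTensor A).lTensor A
            (TensorProduct.assoc ℂ A A A (s ⊗ₜ y))
            = TensorProduct.assoc ℂ A A A ((LinearMap.mulRight ℂ w).lTensor A s ⊗ₜ y) := by
          intro s
          induction s with
          | zero => simp
          | add x y hx hy => simp only [TensorProduct.add_tmul, map_add, hx, hy]
          | tmul x y => simp
        rw [h₂, H.lTensor_T₂, LinearMap.rTensor_tmul, LinearMap.comp_apply, LinearMap.flip_apply,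
          TensorProduct.mk_apply, LinearEquiv.coe_coe]
        induction H.T₁ (x ⊗ₜ w) with
        | zero => simp
        | add x y hx hy => simp only [TensorProduct.add_tmul, map_add, hx, hy]
        | tmul x y => simp
    rw [comul₃_tmul, h₁, ← H.leg₂₃_tmul, H.leg₁₂_leg₂₃, H.leg₁₂_tmul]
    induction H.T₂ (c ⊗ₜ a) with
    | zero => simp
    | add x y hx hy => simp only [TensorProduct.add_tmul, map_add, hx, hy]
    | tmul x y => simp [H.leg₂₃_tmul, H.comulLeft_tmul]

/-- Coassociativity: if `φ(r e) = Δ(r) z` for all `r`, then `∑ f ⊗ φ(e') = (ι ⊗ Δ)Δ(a)(1 ⊗ z)` where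
`Δ(a)(1 ⊗ e) = ∑ f ⊗ e'`. -/
theorem lTensor_T₁_eq_comul₃ (a e : A) (z : A ⊗[ℂ] A) (φ : A →ₗ[ℂ] A ⊗[ℂ] A)
    (h : ∀ r, φ (r * e) = H.comulLeft r z) :
    φ.lTensor A (H.T₁ (a ⊗ₜ e)) = H.comul₃ a z := by
  apply H.rTensor_ext_left
  intro c
  -- Covering the first leg by c turns Δ(a)(1 ⊗ e) into (c ⊗ 1)Δ(a) followed by right multiplication
  -- by e, which the hypothesis on φ absorbs.
  rw [mulLeft_comul₃, ← LinearMap.comp_apply, LinearMap.rTensor_comp_lTensor,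
    ← LinearMap.lTensor_comp_rTensor, LinearMap.comp_apply, ← H.lTensor_T₂,
    ← LinearMap.lTensor_comp_apply]
  congr 2
  ext r
  exact h r

end MultiplierHopfAlgebra

/-! ### The bicrossproduct formula, computed in A ⊗ A ⊗ A ⊗ A. -/

namespace RegularMultiplierHopfAlgebra

variable {A : Type*} [NonUnitalRing A] [Module ℂ A] [SMulCommClass ℂ A A] [IsScalarTower ℂ A A]
  (H : RegularMultiplierHopfAlgebra A)

/-- `x ⊗ (r ⊗ g) ↦ ∑ T₁(x ⊗ S(r₍₁₎) g) ⊗ r₍₂₎`, if `G(r ⊗ g) = ∑ S(r₍₁₎) g ⊗ r₍₂₎`. -/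
def untwist (G : A ⊗[ℂ] A →ₗ[ℂ] A ⊗[ℂ] A) : A ⊗[ℂ] (A ⊗[ℂ] A) →ₗ[ℂ] (A ⊗[ℂ] A) ⊗[ℂ] A :=
  H.T₁.toLinearMap.rTensor A ∘ₗ (TensorProduct.assoc ℂ A A A).symm.toLinearMap ∘ₗ G.lTensor A

/-- The cancellation of the antipode: `T₁` undoes ∑ pf₍₁₎ ⊗ S(f₍₂₎)g into Δ(p)(f ⊗ g), by the same
identity that describes θ. Coassociativity first separates off the leg covered by e. -/
theorem lTensor_untwist {G : A ⊗[ℂ] A →ₗ[ℂ] A ⊗[ℂ] A}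
    (hG : ∀ z c, (LinearMap.mulRight ℂ c).lTensor A (G z) = H.antipodeTwist c z) (p f g e : A) :
    (LinearMap.mulRight ℂ e).lTensor (A ⊗[ℂ] A) (H.untwist G (H.leg₁₂ (p ⊗ₜ (f ⊗ₜ g))))
      = (H.comulLeft p ∘ₗ (TensorProduct.mk ℂ A A).flip g).rTensor A (H.T₁ (f ⊗ₜ e)) := by
  have h₁ : ∀ y : A ⊗[ℂ] (A ⊗[ℂ] A),
      (LinearMap.mulRight ℂ e).lTensor (A ⊗[ℂ] A) (H.untwist G y)
        = H.T₁.toLinearMap.rTensor A ((TensorProduct.assoc ℂ A A A).symm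
            ((H.antipodeTwist e).lTensor A y)) := by
    intro y
    induction y with
    | zero => simp
    | add x y hx hy => simp only [map_add, hx, hy]
    | tmul x z =>
      rw [LinearMap.lTensor_tmul, ← hG]
      simp only [untwist, LinearMap.comp_apply, LinearMap.lTensor_tmul, LinearEquiv.coe_coe]
      induction G z with
      | zero => simp
      | add x y hx hy => simp only [TensorProduct.tmul_add, map_add, hx, hy]
      | tmul x y => simp
  have h₂ : ∀ t : A ⊗[ℂ] A,
      (H.antipodeTwist e).lTensor A (TensorProduct.assoc ℂ A A A (t ⊗ₜ g))
        = ((LinearMap.mulRight ℂ g ∘ₗ H.antipode).rTensor A).lTensor A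
            (H.leg₂₃ (TensorProduct.assoc ℂ A A A (t ⊗ₜ e))) := by
    intro t
    induction t with
    | zero => simp
    | add x y hx hy => simp only [TensorProduct.add_tmul, map_add, hx, hy]
    | tmul x y => simp [H.leg₂₃_tmul, antipodeTwist_tmul]
  rw [h₁, H.leg₁₂_tmul, h₂, ← H.leg₁₂_tmul, ← H.leg₁₂_leg₂₃, H.leg₂₃_tmul]
  induction H.T₁ (f ⊗ₜ e) with
  | zero => simp
  | add x y hx hy => simp only [TensorProduct.tmul_add, map_add, hx, hy]
  | tmul x y =>
    have h₃ : ∀ t : A ⊗[ℂ] A, ((LinearMap.mulRight ℂ g ∘ₗ H.antipode).rTensor A).lTensor A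
        (TensorProduct.assoc ℂ A A A (t ⊗ₜ y)) = TensorProduct.assoc ℂ A A A
          ((LinearMap.mulRight ℂ g ∘ₗ H.antipode).lTensor A t ⊗ₜ y) := by
      intro t
      induction t with
      | zero => simp
      | add x y hx hy => simp only [TensorProduct.add_tmul, map_add, hx, hy]
      | tmul x y => simp
    have h₄ := H.isTheta_theta p x g
    simp only [theta, LinearEquiv.coe_coe, LinearEquiv.trans_apply,
      LinearEquiv.symm_apply_apply] at h₄
    rw [H.leg₁₂_tmul, h₃, ← h₄, LinearEquiv.symm_apply_apply, LinearMap.rTensor_tmul,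
      LinearEquiv.coe_coe, H.T₁_mul_left, LinearEquiv.apply_symm_apply, LinearMap.rTensor_tmul]
    rfl

theorem map_untwist {G : A ⊗[ℂ] A →ₗ[ℂ] A ⊗[ℂ] A}
    (hG : ∀ z c, (LinearMap.mulRight ℂ c).lTensor A (G z) = H.antipodeTwist c z) (p f g u v : A)
    (h : A ⊗[ℂ] A) :
    TensorProduct.map (LinearMap.mulRight ℂ (u ⊗ₜ[ℂ] v)) (H.comulLeft.flip h)
        (H.untwist G (H.leg₁₂ (p ⊗ₜ (f ⊗ₜ g))))
      = (H.comulLeft p ∘ₗ (TensorProduct.mk ℂ A A).flip (g * v)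
          ∘ₗ LinearMap.mulRight ℂ u).rTensor (A ⊗[ℂ] A) (H.comul₃ f h) := by
  -- Writing h as `T₁ (e ⊗ₜ k)` gives Δ(r)h = Δ(re)(1 ⊗ k), which provides the cover e needed by
  -- `lTensor_untwist`.
  obtain ⟨h, rfl⟩ := H.T₁.surjective h
  induction h with
  | zero => simp [TensorProduct.map_zero_right]
  | add x y hx hy => simp only [map_add, TensorProduct.map_add_right, LinearMap.add_apply, hx, hy]
  | tmul e k =>
    rw [← H.lTensor_T₁_eq_comul₃ f e (H.T₁ (e ⊗ₜ k))
      (H.T₁.toLinearMap ∘ₗ (TensorProduct.mk ℂ A A).flip k)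
      (fun r => by simp [← H.T₁_mul_left])]
    have h₁ : H.comulLeft.flip (H.T₁ (e ⊗ₜ k))
        = (H.T₁.toLinearMap ∘ₗ (TensorProduct.mk ℂ A A).flip k) ∘ₗ LinearMap.mulRight ℂ e := by
      ext r
      simp [← H.T₁_mul_left]
    have h₂ : ∀ y : (A ⊗[ℂ] A) ⊗[ℂ] A,
        TensorProduct.map (LinearMap.mulRight ℂ (u ⊗ₜ[ℂ] v)) (H.comulLeft.flip (H.T₁ (e ⊗ₜ k))) y
          = TensorProduct.map (LinearMap.mulRight ℂ (u ⊗ₜ[ℂ] v))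
              (H.T₁.toLinearMap ∘ₗ (TensorProduct.mk ℂ A A).flip k)
              ((LinearMap.mulRight ℂ e).lTensor (A ⊗[ℂ] A) y) := by
      intro y
      rw [h₁, ← LinearMap.comp_apply (TensorProduct.map _ _), LinearMap.map_comp_lTensor]
    rw [h₂, H.lTensor_untwist hG]
    induction H.T₁ (f ⊗ₜ e) with
    | zero => simp
    | add x y hx hy => simp only [map_add, hx, hy]
    | tmul x y =>
      simp [← H.comulLeft_mul_right]

theorem map_T₁_onMiddle (G : A ⊗[ℂ] A →ₗ[ℂ] A ⊗[ℂ] A) (p a s t : A) :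
    TensorProduct.map H.T₁.toLinearMap H.T₁.toLinearMap
        (onMiddle (G ∘ₗ H.T₁.toLinearMap) (H.T₂ (p ⊗ₜ a) ⊗ₜ (s ⊗ₜ t)))
      = (H.T₁.toLinearMap ∘ₗ (TensorProduct.mk ℂ A A).flip t).lTensor (A ⊗[ℂ] A)
          (H.untwist G (H.leg₁₂ (p ⊗ₜ H.T₁ (a ⊗ₜ s)))) := by
  rw [← H.leg₂₃_tmul, H.leg₁₂_leg₂₃, H.leg₁₂_tmul]
  induction H.T₂ (p ⊗ₜ a) with
  | zero => simp
  | add x y hx hy => simp only [TensorProduct.add_tmul, map_add, hx, hy]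
  | tmul x r =>
    rw [onMiddle_tmul, TensorProduct.assoc_tmul, H.leg₂₃_tmul, untwist, LinearMap.comp_apply,
      LinearMap.comp_apply, LinearMap.comp_apply, LinearMap.lTensor_tmul]
    simp only [LinearEquiv.coe_coe]
    induction G (H.T₁ (r ⊗ₜ s)) with
    | zero => simp
    | add x y hx hy => simp only [TensorProduct.tmul_add, map_add, hx, hy]
    | tmul x y => simp

/-- The Γ side of the formula in normal form, ∑ a₍₁₎u ⊗ a₍₄₎sv ⊗ a₍₂₎w ⊗ a₍₃₎ty with Δ(p) acting on
the first two legs. No antipode is left. -/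
theorem map_T₁_onMiddle_mul {G : A ⊗[ℂ] A →ₗ[ℂ] A ⊗[ℂ] A}
    (hG : ∀ z c, (LinearMap.mulRight ℂ c).lTensor A (G z) = H.antipodeTwist c z)
    (p a s t u v w y : A) :
    TensorProduct.map H.T₁.toLinearMap H.T₁.toLinearMap
        (onMiddle (G ∘ₗ H.T₁.toLinearMap) (H.T₂ (p ⊗ₜ a) ⊗ₜ (s ⊗ₜ t)))
          * ((u ⊗ₜ v) ⊗ₜ (w ⊗ₜ y))
      = (H.comulLeft p).rTensor (A ⊗[ℂ] A) (TensorProduct.tensorTensorTensorComm ℂ A A A A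
          ((H.comulLeft.flip (u ⊗ₜ w)).rTensor (A ⊗[ℂ] A)
            ((TensorProduct.comm ℂ A A).toLinearMap.lTensor A
              (H.comul₃ a ((t * y) ⊗ₜ (s * v)))))) := by
  have h₁ : ∀ Z : (A ⊗[ℂ] A) ⊗[ℂ] A,
      (H.T₁.toLinearMap ∘ₗ (TensorProduct.mk ℂ A A).flip t).lTensor (A ⊗[ℂ] A) Z
          * ((u ⊗ₜ v) ⊗ₜ (w ⊗ₜ y))
        = TensorProduct.map (LinearMap.mulRight ℂ (u ⊗ₜ[ℂ] v))
            (H.comulLeft.flip (w ⊗ₜ (t * y))) Z := by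
    intro Z
    induction Z with
    | zero => simp
    | add x y hx hy => simp only [map_add, add_mul, hx, hy]
    | tmul x y => simp [H.T₁_mul]
  have h₂ : H.T₁ (a ⊗ₜ (s * v)) = (LinearMap.mulRight ℂ v).lTensor A (H.T₁ (a ⊗ₜ s)) := by
    rw [← H.T₁_lTensor, LinearMap.lTensor_tmul, LinearMap.mulRight_apply]
  rw [map_T₁_onMiddle, h₁, H.comul₃_tmul, h₂]
  induction H.T₁ (a ⊗ₜ s) with
  | zero => simp
  | add x y hx hy => simp only [TensorProduct.tmul_add, map_add, hx, hy]
  | tmul f g =>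
    rw [H.map_untwist hG, H.comul₃_tmul, LinearMap.rTensor_comp_apply]
    congr 1
    simp only [LinearMap.lTensor_tmul, LinearMap.rTensor_tmul, LinearMap.comp_apply,
      LinearMap.flip_apply, TensorProduct.mk_apply, LinearEquiv.coe_coe, LinearMap.mulRight_apply]
    induction H.T₁ (f ⊗ₜ (t * y)) with
    | zero => simp
    | add x y hx hy => simp only [TensorProduct.add_tmul, map_add, hx, hy]
    | tmul x z =>
      simp only [TensorProduct.assoc_tmul, LinearMap.lTensor_tmul, LinearMap.rTensor_tmul,
        LinearEquiv.coe_coe, TensorProduct.comm_tmul, LinearMap.flip_apply, H.comulLeft_tmul,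
        LinearMap.comp_apply, TensorProduct.mk_apply]
      induction H.T₁ (x ⊗ₜ w) with
      | zero => simp
      | add x y hx hy => simp only [TensorProduct.add_tmul, map_add, hx, hy]
      | tmul x y => simp

/-- The tensor product side in the same normal form. The flip in Δ^cop accounts for the leg order 1,
4, 2, 3, and coassociativity gathers Δ(a₍₂₎b) into the iterated coproduct of a. -/
theorem tensorComul_T₁ (a b q u v w y : A) :
    (tensorComul H.comul H.cop.comul (H.T₁ (a ⊗ₜ b))).1.1 ((u ⊗ₜ v) ⊗ₜ (w ⊗ₜ (q * y)))
      = TensorProduct.tensorTensorTensorComm ℂ A A A A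
          ((H.comulLeft.flip (u ⊗ₜ w)).rTensor (A ⊗[ℂ] A)
            ((TensorProduct.comm ℂ A A).toLinearMap.lTensor A
              (H.comul₃ a (TensorProduct.comm ℂ A A (H.cop.T₁ (b ⊗ₜ q) * (v ⊗ₜ y)))))) := by
  have h₁ : TensorProduct.comm ℂ A A (H.cop.T₁ (b ⊗ₜ q) * (v ⊗ₜ y))
      = H.comulLeft b ((q * y) ⊗ₜ v) := by
    rw [H.cop.T₁_mul, cop_comulLeft, TensorProduct.comm_comm, LinearMap.lTensor_tmul,
      TensorProduct.comm_tmul, LinearMap.mulLeft_apply]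
  rw [h₁, ← H.lTensor_T₁_eq_comul₃ a b (H.comulLeft b ((q * y) ⊗ₜ v))
    (H.comulLeft.flip ((q * y) ⊗ₜ v)) (fun r => H.comulLeft_mul r b _)]
  induction H.T₁ (a ⊗ₜ b) with
  | zero => simp
  | add x y hx hy =>
    simp only [map_add, Subalgebra.coe_add, Prod.fst_add, LinearMap.add_apply, hx, hy]
  | tmul x r =>
    have h₂ : TensorProduct.comm ℂ A A (H.comulLeft r ((q * y) ⊗ₜ v))
        = (H.cop.comul r).1.1 (v ⊗ₜ (q * y)) := by
      change _ = H.cop.comulLeft r (v ⊗ₜ (q * y))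
      rw [cop_comulLeft, TensorProduct.comm_tmul]
    rw [coe_tensorComul_tmul]
    simp only [LinearMap.lTensor_tmul, LinearMap.flip_apply, LinearEquiv.coe_coe,
      LinearMap.rTensor_tmul, h₂]
    simp [BiOp.congr, BiOp.tensor, MultiplierHopfAlgebra.comulLeft_apply]

/-- Non-degeneracy reduces this to left actions on elementary tensors. Expanding Δ^cop(b)(1 ⊗ q)
into terms s ⊗ t then makes the two normal forms coincide. -/
theorem tensorComul_covered {G : A ⊗[ℂ] A →ₗ[ℂ] A ⊗[ℂ] A}
    (hG : ∀ z c, (LinearMap.mulRight ℂ c).lTensor A (G z) = H.antipodeTwist c z) (p a b q : A) :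
    BiOp.tensor (H.comul p : BiOp (A ⊗[ℂ] A)) 1
        * (tensorComul H.comul H.cop.comul (H.T₁ (a ⊗ₜ b)) :
            BiOp ((A ⊗[ℂ] A) ⊗[ℂ] (A ⊗[ℂ] A)))
        * BiOp.tensor 1 (BiOp.tensor 1 (BiOp.ofElem q))
      = BiOp.ofElem (TensorProduct.map H.T₁.toLinearMap H.T₁.toLinearMap
          (onMiddle (G ∘ₗ H.T₁.toLinearMap) (H.T₂ (p ⊗ₜ a) ⊗ₜ H.cop.T₁ (b ⊗ₜ q)))) := by
  apply Multiplier.ext_left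
  · intro x y h
    apply tensor_nondeg_left
    · intro z hz
      exact H.tensor_ext_right fun u v => by rw [hz, zero_mul]
    · intro z hz
      exact H.tensor_ext_right fun u v => by rw [hz, zero_mul]
    · intro u v
      exact h _
  · exact mul_mem (mul_mem (BiOp.tensor_mem (H.comul p).2 (one_mem _)) (Subtype.property _))
      (BiOp.tensor_mem (one_mem _) (BiOp.tensor_mem (one_mem _) (BiOp.ofElem_mem _root_.mul_assoc q)))
  · exact BiOp.ofElem_mem (tensor_mul_assoc _root_.mul_assoc _root_.mul_assoc) _
  · apply TensorProduct.ext_fourfold'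
    intro u v w y
    change (H.comulLeft p).rTensor (A ⊗[ℂ] A) ((tensorComul H.comul H.cop.comul
      (H.T₁ (a ⊗ₜ b))).1.1 ((u ⊗ₜ v) ⊗ₜ (w ⊗ₜ (q * y)))) = _ * _
    rw [tensorComul_T₁]
    induction H.cop.T₁ (b ⊗ₜ q) with
    | zero => simp
    | add x y hx hy => simp only [TensorProduct.tmul_add, map_add, add_mul, hx, hy]
    | tmul s t =>
      rw [H.map_T₁_onMiddle_mul hG, Algebra.TensorProduct.tmul_mul_tmul, TensorProduct.comm_tmul]

/-! ### Identification of the bicrossproduct with the transported tensor product. -/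

theorem comulRight_T₁ (a b p : A) :
    H.comulRight p (H.T₁ (a ⊗ₜ b)) = H.comulLeft a (H.T₄ (b ⊗ₜ p)) := by
  apply H.tensor_ext_right
  intro u v
  rw [← H.mul_comulLeft, ← H.comulLeft_mul_right, T₄_mul, H.T₁_mul]

/-- On the left, `T₁` turns multiplication by p on the first leg into Δ(p). On the right, moving p
past b uses the twist, which `T₁` converts into (1 ⊗ b)Δ(p). -/
theorem inl_eq (p : A) :
    SmashProduct.inl H.toMultiplierHopfAlgebra H.adjointAction p
      = BiOp.congr H.theta (H.comul p : BiOp (A ⊗[ℂ] A)) := by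
  apply BiOp.ext'
  · intro x
    apply H.theta.symm.injective
    obtain ⟨x, rfl⟩ := (SmashProduct.ofTensor _ _).surjective x
    change H.T₁ ((LinearMap.mulLeft ℂ p).rTensor A x)
      = H.theta.symm (H.theta (H.comulLeft p (H.T₁ x)))
    rw [H.T₁_mul_left, LinearEquiv.symm_apply_apply]
  · intro x
    apply H.theta.symm.injective
    obtain ⟨x, rfl⟩ := (SmashProduct.ofTensor _ _).surjective x
    change H.T₁ ((LinearMap.mul' ℂ A).rTensor A ((TensorProduct.assoc ℂ A A A).symm
        ((smashTwist H.toMultiplierHopfAlgebra H.adjointAction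
          ∘ₗ (TensorProduct.mk ℂ A A).flip p).lTensor A x)))
      = H.theta.symm (H.theta (H.comulRight p (H.T₁ x)))
    rw [LinearEquiv.symm_apply_apply]
    induction x with
    | zero => simp
    | add x y hx hy => simp only [map_add, hx, hy]
    | tmul a b =>
      rw [LinearMap.lTensor_tmul, MultiplierHopfAlgebra.mul'_rTensor_assoc, H.T₁_mul_left, LinearMap.comp_apply,
        T₁_smashTwist, comulRight_T₁]
      rfl

theorem inr_eq (q : A) :
    SmashProduct.inr H.toMultiplierHopfAlgebra H.adjointAction q
      = BiOp.congr H.theta (BiOp.tensor 1 (BiOp.ofElem q)) := by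
  apply BiOp.ext'
  · intro x
    apply H.theta.symm.injective
    obtain ⟨x, rfl⟩ := (SmashProduct.ofTensor _ _).surjective x
    change H.T₁ ((LinearMap.mul' ℂ A).lTensor A ((TensorProduct.assoc ℂ A A A)
        ((smashTwist H.toMultiplierHopfAlgebra H.adjointAction
          ∘ₗ TensorProduct.mk ℂ A A q).rTensor A x)))
      = H.theta.symm (H.theta ((LinearMap.mulLeft ℂ q).lTensor A (H.T₁ x)))
    rw [LinearEquiv.symm_apply_apply]
    induction x with
    | zero => simp
    | add x y hx hy => simp only [map_add, hx, hy]
    | tmul a b =>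
      rw [LinearMap.rTensor_tmul, MultiplierHopfAlgebra.mul'_lTensor_assoc, H.T₁_lTensor, LinearMap.comp_apply,
        T₁_smashTwist, TensorProduct.mk_apply, lTensor_T₄]
  · intro x
    apply H.theta.symm.injective
    obtain ⟨x, rfl⟩ := (SmashProduct.ofTensor _ _).surjective x
    change H.T₁ ((LinearMap.mulRight ℂ q).lTensor A x)
      = H.theta.symm (H.theta ((LinearMap.mulRight ℂ q).lTensor A (H.T₁ x)))
    rw [H.T₁_lTensor, LinearEquiv.symm_apply_apply]

theorem theta_T₁ (x : A ⊗[ℂ] A) : H.theta (H.T₁ x) = SmashProduct.ofTensor _ _ x :=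
  congrArg (SmashProduct.ofTensor _ _) (H.T₁.symm_apply_apply x)

theorem congr_theta_map_T₁ (z : (A ⊗[ℂ] A) ⊗[ℂ] (A ⊗[ℂ] A)) :
    TensorProduct.congr H.theta H.theta
        (TensorProduct.map H.T₁.toLinearMap H.T₁.toLinearMap z)
      = TensorProduct.map
          (SmashProduct.ofTensor H.toMultiplierHopfAlgebra H.adjointAction).toLinearMap
          (SmashProduct.ofTensor H.toMultiplierHopfAlgebra H.adjointAction).toLinearMap z := by
  induction z with
  | zero => simp only [map_zero]
  | add x y hx hy => simp only [map_add, hx, hy]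
  | tmul x y =>
    rw [TensorProduct.map_tmul, TensorProduct.congr_tmul, TensorProduct.map_tmul,
      LinearEquiv.coe_coe, LinearEquiv.coe_coe, theta_T₁, theta_T₁]

/-- Pulling everything back along θ replaces p by Δ(p), q by 1 ⊗ q and a # b by Δ(a)(1 ⊗ b), so the
claim becomes `tensorComul_covered`. -/
theorem isBicrossComul_transport :
    IsBicrossComul H.toMultiplierHopfAlgebra H.cop.toMultiplierHopfAlgebra H.adjointAction
      H.adjointCoaction ((H.tensor H.cop).transport H.theta H.theta_mul).comul := by
  obtain ⟨G, hG⟩ := H.exists_uncovered_antipodeTwist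
  refine ⟨G ∘ₗ H.T₁.toLinearMap, H.adjointCoaction_mul_tensor hG, fun p a b q => ?_⟩
  rw [transport_comul, tensor_comul, inl_eq, inr_eq, coe_transportComul, ← BiOp.congr_one H.theta, BiOp.tensor_congr,
    BiOp.tensor_congr, ← BiOp.congr_mul, ← BiOp.congr_mul]
  have h : H.theta.symm (SmashProduct.ofTensor _ _ (a ⊗ₜ b)) = H.T₁ (a ⊗ₜ b) := rfl
  rw [h, H.tensorComul_covered hG,
    BiOp.congr_ofElem _ (tensorCongr_mul _ _ H.theta_mul H.theta_mul)]
  rw [congr_theta_map_T₁]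

end RegularMultiplierHopfAlgebra

end

theorem proposition4p2 {A : Type*} [NonUnitalRing A] [Module ℂ A] [SMulCommClass ℂ A A]
    [IsScalarTower ℂ A A] (H : RegularMultiplierHopfAlgebra A) :
    -- the counit, the antipode and the twist map of the adjoint action exist
    H.IsCounit H.counit ∧ H.IsAntipode H.antipode ∧
    IsSmashTwist H.toMultiplierHopfAlgebra H.adjointAction
      (smashTwist H.toMultiplierHopfAlgebra H.adjointAction) ∧
    -- the adjoint coaction `Γ`, the tensor product `T` of `A` and `B = (A, Δ^cop)`,
    -- the bicrossproduct `P` and the isomorphism `θ` exist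
    ∃ (Γ : A →ₗ[ℂ] Multiplier (A ⊗[ℂ] A))
      (T : RegularMultiplierHopfAlgebra (A ⊗[ℂ] A))
      (P : RegularMultiplierHopfAlgebra
        (SmashProduct H.toMultiplierHopfAlgebra H.adjointAction))
      (θ : A ⊗[ℂ] A ≃ₗ[ℂ] SmashProduct H.toMultiplierHopfAlgebra H.adjointAction),
      H.IsAdjointCoaction Γ ∧
      T.comul = tensorComul H.comul H.cop.comul ∧
      IsBicrossComul H.toMultiplierHopfAlgebra H.cop.toMultiplierHopfAlgebra
        H.adjointAction Γ P.comul ∧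
      H.IsTheta θ.toLinearMap ∧
      T.toMultiplierHopfAlgebra.IsIso P.toMultiplierHopfAlgebra θ :=
  ⟨H.isCounit_counit, H.isAntipode_antipode, H.isSmashTwist_smashTwist, H.adjointCoaction,
    H.tensor H.cop, (H.tensor H.cop).transport H.theta H.theta_mul, H.theta,
    H.isAdjointCoaction_adjointCoaction, rfl, H.isBicrossComul_transport, H.isTheta_theta,
    (H.tensor H.cop).isIso_transport H.theta H.theta_mul⟩
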